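/- Let $N\in\mathbb{N}$. A bounded continuous function $u$ on $\mathbb{R}^N$ is (Bohr) almost periodic if the set of its translates $\{u(\cdot+a):a\in\mathbb{R}^N\}$ is relatively compact for the sup norm; if $u$ is complex-valued, its mean value $\mathfrak{M}(u)$ is the unique constant in the closed convex hull of its translates. Let $AP^\infty(\mathbb{R}^N)$ be the space of complex-valued smooth functions all of whose partial derivatives are almost periodic, with the Fréchet topology given by the norms $|||u|||_m=\sup_{|\alpha|\le m}\sup_y|D^\alpha u(y)|$, $m\in\mathbb{N}$. Let $\mathcal{D}_{L^1}(\mathbb{R}^N)$ be the space of smooth functions that are integrable together with all their derivatives, with the topology given by the seminorms $\varphi\mapsto\|D^\alpha\varphi\|_{L^1}$, and let $\mathcal{B}'_\infty(\mathbb{R}^N)$, the space of bounded distributions, be its topological dual with the strong dual topology. For $T\in\mathcal{B}'_\infty(\mathbb{R}^N)$, $a\in\mathbb{R}^N$ and $\varphi\in AP^\infty(\mathbb{R}^N)$ put $\langle\tau_aT,\psi\rangle=\langle T,\psi(\cdot-a)\rangle$ and $\langle\varphi T,\psi\rangle=\langle T,\varphi\psi\rangle$ for $\psi\in\mathcal{D}_{L^1}(\mathbb{R}^N)$.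 The space $\mathcal{B}'_{AP}(\mathbb{R}^N)$ of almost periodic distributions consists of those $T\in\mathcal{B}'_\infty(\mathbb{R}^N)$ for which $\{\tau_aT:a\in\mathbb{R}^N\}$ is relatively compact in $\mathcal{B}'_\infty(\mathbb{R}^N)$, and carries the relative topology. A function $u\in AP^\infty(\mathbb{R}^N)$ is identified with the distribution $\psi\mapsto\int u\psi$. Let $B^1_{AP}(\mathbb{R}^N)$ be the closure of the almost periodic functions for the Besicovitch seminorm $\|u\|_1=\limsup_{r\to\infty}|B_r|^{-1}\int_{B_r}|u|$, where $B_r$ is the ball of radius $r$ centred at $0$; let $\mathcal{N}=\{u\in B^1_{AP}(\mathbb{R}^N):\|u\|_1=0\}$ and $\varrho(u)=u+\mathcal{N}$. Let $\mathcal{D}_{AP}(\mathbb{R}^N)=\varrho(AP^\infty(\mathbb{R}^N))\subset B^1_{AP}(\mathbb{R}^N)/\mathcal{N}$, with the topology given by the norms $N_n(\varrho(u))=\sup_{|\alpha|\le n}\sup_y|D^\alpha u(y)|$ for $u\in AP^\infty(\mathbb{R}^N)$, $n\in\mathbb{N}$ (these are well defined because $\varrho$ is injective on $AP^\infty(\mathbb{R}^N)$).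 Let $\mathcal{D}'_{AP}(\mathbb{R}^N)$, the space of distributions on $\mathcal{D}_{AP}(\mathbb{R}^N)$, be its topological dual with the strong dual topology. **Proposition.** Every $u\in AP^\infty(\mathbb{R}^N)$ belongs to $\mathcal{B}'_{AP}(\mathbb{R}^N)$, and the mean value on $AP^\infty(\mathbb{R}^N)$ extends to a unique continuous linear form, still denoted by $\mathfrak{M}$, on $\mathcal{B}'_{AP}(\mathbb{R}^N)$. For all $T\in\mathcal{B}'_{AP}(\mathbb{R}^N)$ and $\varphi\in AP^\infty(\mathbb{R}^N)$ one has $\varphi T\in\mathcal{B}'_{AP}(\mathbb{R}^N)$, and for each $T\in\mathcal{B}'_{AP}(\mathbb{R}^N)$ the linear form $\Phi(T):\mathcal{D}_{AP}(\mathbb{R}^N)\to\mathbb{C}$ given by $$\langle\Phi(T),\varrho(\varphi)\rangle=\mathfrak{M}(\varphi T)\qquad(\varphi\in AP^\infty(\mathbb{R}^N))$$ is a distribution on $\mathcal{D}_{AP}(\mathbb{R}^N)$. The map $\Phi:T\mapsto\Phi(T)$ is a continuous injective linear map of $\mathcal{B}'_{AP}(\mathbb{R}^N)$ into $\mathcal{D}'_{AP}(\mathbb{R}^N)$.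 -/

import Mathlib

open scoped ContDiff ENNReal NNReal BoundedContinuousFunction Topology
open MeasureTheory Filter

noncomputable section

namespace APDist

/-- The Euclidean space `ℝ^N`. -/
abbrev Eu (N : ℕ) : Type := EuclideanSpace ℝ (Fin N)

/-! ### Bohr almost periodic functions and their mean value -/

section AP

variable {N : ℕ} {F : Type*} [NormedAddCommGroup F]

/-- The translate `f(· + a)` of a bounded continuous function. -/
def bcfTranslate (a : Eu N) (f : Eu N →ᵇ F) : Eu N →ᵇ F :=
  f.compContinuous ⟨fun x => x + a, by fun_prop⟩

/-- Bohr almost periodic functions: bounded continuous functions whose set of translates has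
compact closure for the sup norm. (The target `F` is arbitrary, so that the notion applies to
scalar functions and to their total derivatives.) -/
def IsBohrAP (u : Eu N → F) : Prop :=
  ∃ f : Eu N →ᵇ F, ⇑f = u ∧ IsCompact (closure (Set.range fun a => bcfTranslate a f))

/-- `c` is the mean value `𝔐(u)` of `u`: the constant function `c` belongs to the closed convex
hull, in the space of bounded continuous functions, of the set of translates of `u`. -/
def IsMeanValue (u : Eu N → ℂ) (c : ℂ) : Prop :=
  ∃ f : Eu N →ᵇ ℂ, ⇑f = u ∧ BoundedContinuousFunction.const (Eu N) c ∈
    closure (convexHull ℝ (Set.range fun a => bcfTranslate a f))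

lemma IsBohrAP.zero : IsBohrAP (0 : Eu N → F) := by
  refine ⟨0, rfl, ?_⟩
  refine (isCompact_singleton (x := (0 : Eu N →ᵇ F))).closure_of_subset ?_
  rintro _ ⟨a, rfl⟩
  rfl

lemma IsBohrAP.add {u v : Eu N → F} (hu : IsBohrAP u) (hv : IsBohrAP v) : IsBohrAP (u + v) := by
  obtain ⟨f, rfl, hf⟩ := hu
  obtain ⟨g, rfl, hg⟩ := hv
  refine ⟨f + g, rfl, (hf.add hg).closure_of_subset ?_⟩
  rintro _ ⟨a, rfl⟩
  exact Set.add_mem_add (subset_closure (Set.mem_range_self a))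
      (subset_closure (Set.mem_range_self a))

lemma IsBohrAP.smul [NormedSpace ℂ F] {u : Eu N → F} (hu : IsBohrAP u) (c : ℂ) :
    IsBohrAP (c • u) := by
  obtain ⟨f, rfl, hf⟩ := hu
  refine ⟨c • f, rfl, (hf.smul c).closure_of_subset ?_⟩
  rintro _ ⟨a, rfl⟩
  exact Set.smul_mem_smul_set (subset_closure (Set.mem_range_self a))

lemma IsBohrAP.continuous {u : Eu N → F} (hu : IsBohrAP u) : Continuous u := by
  obtain ⟨f, rfl, -⟩ := hu
  exact f.continuous

lemma IsBohrAP.exists_bound {u : Eu N → F} (hu : IsBohrAP u) : ∃ C, ∀ x, ‖u x‖ ≤ C := by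
  obtain ⟨f, rfl, -⟩ := hu
  exact ⟨‖f‖, f.norm_coe_le_norm⟩

end AP

/-! ### The space `AP^∞` -/

/-- The smooth functions all of whose derivatives are almost periodic. The `k`-th order partial
derivatives of `u` are the components of `iteratedFDeriv ℝ k u`, which takes its values in a
finite-dimensional space; so the latter is almost periodic iff all of the former are. -/
def apInftySubmodule (N : ℕ) : Submodule ℂ (Eu N → ℂ) where
  carrier := {u | ContDiff ℝ ∞ u ∧ ∀ k : ℕ, IsBohrAP (iteratedFDeriv ℝ k u)}
  zero_mem' := by
    refine ⟨contDiff_const, fun k => ?_⟩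
    rw [Pi.zero_def, iteratedFDeriv_fun_zero]
    exact IsBohrAP.zero
  add_mem' := by
    rintro u v ⟨hu, hu'⟩ ⟨hv, hv'⟩
    refine ⟨hu.add hv, fun k => ?_⟩
    rw [iteratedFDeriv_add (hu.of_le (mod_cast le_top)) (hv.of_le (mod_cast le_top))]
    exact (hu' k).add (hv' k)
  smul_mem' := by
    rintro c u ⟨hu, hu'⟩
    refine ⟨hu.const_smul c, fun k => ?_⟩
    have : iteratedFDeriv ℝ k (c • u) = c • iteratedFDeriv ℝ k u := by
      ext1 x
      exact iteratedFDeriv_const_smul_apply (hu.of_le (mod_cast le_top)).contDiffAt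
    rw [this]
    exact (hu' k).smul c

/-- The space `AP^∞(ℝ^N)`. -/
def APInfty (N : ℕ) : Type := apInftySubmodule N

namespace APInfty

variable {N : ℕ}

instance : AddCommGroup (APInfty N) := inferInstanceAs (AddCommGroup (apInftySubmodule N))
instance : Module ℂ (APInfty N) := inferInstanceAs (Module ℂ (apInftySubmodule N))
instance : CoeFun (APInfty N) (fun _ => Eu N → ℂ) := ⟨fun u => u.1⟩

lemma contDiff (u : APInfty N) : ContDiff ℝ ∞ u := u.2.1

lemma contDiff_nat (u : APInfty N) (k : ℕ) : ContDiff ℝ k u := u.2.1.of_le (mod_cast le_top)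

lemma isBohrAP_deriv (u : APInfty N) (k : ℕ) : IsBohrAP (iteratedFDeriv ℝ k u) := u.2.2 k

lemma isBohrAP (u : APInfty N) : IsBohrAP (u : Eu N → ℂ) := by
  obtain ⟨f, hf, hc⟩ := u.2.2 0
  let L := (continuousMultilinearCurryFin0 ℝ (Eu N) ℂ)
  let c : (Eu N →ᵇ ContinuousMultilinearMap ℝ (fun _ : Fin 0 => Eu N) ℂ) → (Eu N →ᵇ ℂ) :=
    BoundedContinuousFunction.comp L L.lipschitz
  have hcont : Continuous c := BoundedContinuousFunction.continuous_comp L.lipschitz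
  refine ⟨c f, ?_, (hc.image hcont).closure_of_subset ?_⟩
  · ext x
    change L (f x) = u.1 x
    rw [hf]
    simp [L]
  · rintro _ ⟨a, rfl⟩
    exact ⟨_, subset_closure ⟨a, rfl⟩, rfl⟩

lemma bddAbove_deriv (u : APInfty N) (k : ℕ) :
    BddAbove (Set.range fun x => ‖iteratedFDeriv ℝ k u x‖) := by
  obtain ⟨C, hC⟩ := (u.isBohrAP_deriv k).exists_bound
  exact ⟨C, by rintro _ ⟨x, rfl⟩; exact hC x⟩

/-- `sup_y ‖D^k u(y)‖`. -/
def derivSup (N k : ℕ) : Seminorm ℂ (APInfty N) :=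
  Seminorm.ofSMulLE (fun u => ⨆ x, ‖iteratedFDeriv ℝ k u x‖)
    (by
      have : ((0 : APInfty N) : Eu N → ℂ) = fun _ => 0 := rfl
      simp [this, iteratedFDeriv_fun_zero])
    (fun u v => by
      refine ciSup_le fun x => ?_
      have : ((u + v : APInfty N) : Eu N → ℂ) = (u : Eu N → ℂ) + v := rfl
      rw [this, iteratedFDeriv_add_apply (u.contDiff_nat k).contDiffAt
        (v.contDiff_nat k).contDiffAt]
      exact (norm_add_le _ _).trans
        (add_le_add (le_ciSup (u.bddAbove_deriv k) x) (le_ciSup (v.bddAbove_deriv k) x)))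
    (fun c u => by
      refine ciSup_le fun x => ?_
      have : ((c • u : APInfty N) : Eu N → ℂ) = c • (u : Eu N → ℂ) := rfl
      rw [this, iteratedFDeriv_const_smul_apply (u.contDiff_nat k).contDiffAt, norm_smul]
      gcongr
      exact le_ciSup (u.bddAbove_deriv k) x)

/-- The norm `|||u|||_m = sup_{k ≤ m} sup_y ‖D^k u(y)‖`, which is equivalent (with constants that
depend on `N` and `m` only) to the supremum of `|D^α u(y)|` over `y` and `|α| ≤ m`. -/
def norms (N : ℕ) : SeminormFamily ℂ (APInfty N) ℕ :=
  fun m => (Finset.range (m + 1)).sup (derivSup N)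

/-- The Fréchet topology of `AP^∞(ℝ^N)`. -/
instance : TopologicalSpace (APInfty N) := (norms N).moduleFilterBasis.topology

lemma withSeminorms (N : ℕ) : WithSeminorms (norms N) := ⟨rfl⟩

instance : IsTopologicalAddGroup (APInfty N) := (withSeminorms N).topologicalAddGroup
instance : ContinuousSMul ℂ (APInfty N) := (withSeminorms N).continuousSMul

end APInfty

/-! ### Bounded distributions -/

/-- The smooth functions all of whose derivatives are integrable. -/
def smoothL1Submodule (N : ℕ) : Submodule ℂ (Eu N → ℂ) where
  carrier := {φ | ContDiff ℝ ∞ φ ∧ ∀ k : ℕ, Integrable (iteratedFDeriv ℝ k φ) volume}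
  zero_mem' := by
    refine ⟨contDiff_const, fun k => ?_⟩
    rw [Pi.zero_def, iteratedFDeriv_fun_zero]
    exact integrable_zero _ _ _
  add_mem' := by
    rintro u v ⟨hu, hu'⟩ ⟨hv, hv'⟩
    refine ⟨hu.add hv, fun k => ?_⟩
    rw [iteratedFDeriv_add (hu.of_le (mod_cast le_top)) (hv.of_le (mod_cast le_top))]
    exact (hu' k).add (hv' k)
  smul_mem' := by
    rintro c u ⟨hu, hu'⟩
    refine ⟨hu.const_smul c, fun k => ?_⟩
    have : iteratedFDeriv ℝ k (c • u) = c • iteratedFDeriv ℝ k u := by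
      ext1 x
      exact iteratedFDeriv_const_smul_apply (hu.of_le (mod_cast le_top)).contDiffAt
    rw [this]
    exact (hu' k).smul c

/-- The space `𝒟_{L¹}(ℝ^N)` of smooth functions integrable together with all their derivatives. -/
def SmoothL1 (N : ℕ) : Type := smoothL1Submodule N

namespace SmoothL1

variable {N : ℕ}

instance : AddCommGroup (SmoothL1 N) := inferInstanceAs (AddCommGroup (smoothL1Submodule N))
instance : Module ℂ (SmoothL1 N) := inferInstanceAs (Module ℂ (smoothL1Submodule N))
instance : CoeFun (SmoothL1 N) (fun _ => Eu N → ℂ) := ⟨fun u => u.1⟩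

lemma contDiff_nat (u : SmoothL1 N) (k : ℕ) : ContDiff ℝ k u := u.2.1.of_le (mod_cast le_top)

lemma integrable_deriv (u : SmoothL1 N) (k : ℕ) :
    Integrable (iteratedFDeriv ℝ k u) volume := u.2.2 k

lemma integrable (u : SmoothL1 N) : Integrable (u : Eu N → ℂ) volume :=
  (u.integrable_deriv 0).mono (u.contDiff_nat 0).continuous.aestronglyMeasurable
    (Eventually.of_forall fun x => by simp)

/-- The seminorm `∫ ‖D^k φ‖` on `𝒟_{L¹}`. -/
def norms (N : ℕ) : SeminormFamily ℂ (SmoothL1 N) ℕ := fun k =>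
  Seminorm.ofSMulLE (fun u => ∫ x, ‖iteratedFDeriv ℝ k u x‖)
    (by
      have : ((0 : SmoothL1 N) : Eu N → ℂ) = fun _ => 0 := rfl
      simp [this, iteratedFDeriv_fun_zero])
    (fun u v => by
      have : ((u + v : SmoothL1 N) : Eu N → ℂ) = (u : Eu N → ℂ) + v := rfl
      rw [← integral_add (u.integrable_deriv k).norm (v.integrable_deriv k).norm]
      refine integral_mono ((u + v).integrable_deriv k).norm
        ((u.integrable_deriv k).norm.add (v.integrable_deriv k).norm) fun x => ?_
      simp only [this]
      rw [iteratedFDeriv_add_apply (u.contDiff_nat k).contDiffAt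
        (v.contDiff_nat k).contDiffAt]
      exact norm_add_le _ _)
    (fun c u => by
      have : ((c • u : SmoothL1 N) : Eu N → ℂ) = c • (u : Eu N → ℂ) := rfl
      rw [this, ← integral_const_mul]
      refine le_of_eq (integral_congr_ae (Eventually.of_forall fun x => ?_))
      simp only
      rw [iteratedFDeriv_const_smul_apply (u.contDiff_nat k).contDiffAt, norm_smul])

lemma norms_apply (k : ℕ) (u : SmoothL1 N) :
    norms N k u = ∫ x, ‖iteratedFDeriv ℝ k u x‖ := rfl

instance : TopologicalSpace (SmoothL1 N) := (norms N).moduleFilterBasis.topology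

lemma withSeminorms (N : ℕ) : WithSeminorms (norms N) := ⟨rfl⟩

instance : IsTopologicalAddGroup (SmoothL1 N) := (withSeminorms N).topologicalAddGroup
instance : ContinuousSMul ℂ (SmoothL1 N) := (withSeminorms N).continuousSMul

/-- The map `φ ↦ φ(· - a)` on `𝒟_{L¹}`. -/
def shiftLinear (a : Eu N) : SmoothL1 N →ₗ[ℂ] SmoothL1 N where
  toFun φ := ⟨fun x => φ (x - a), φ.2.1.comp (contDiff_id.sub contDiff_const), fun k => by
    rw [iteratedFDeriv_comp_sub']
    exact (φ.integrable_deriv k).comp_sub_right a⟩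
  map_add' _ _ := rfl
  map_smul' _ _ := rfl

/-- The map `φ ↦ φ(· - a)` on `𝒟_{L¹}`, as a continuous linear map. -/
def shift (a : Eu N) : SmoothL1 N →L[ℂ] SmoothL1 N where
  toLinearMap := shiftLinear a
  cont := by
    refine WithSeminorms.continuous_of_isBounded (τ₁₂ := RingHom.id ℂ) (withSeminorms N)
      (withSeminorms N) (shiftLinear a) fun k => ⟨{k}, 1, fun φ => ?_⟩
    simp only [Finset.sup_singleton, one_smul]
    change ∫ x, ‖iteratedFDeriv ℝ k (fun y => φ (y - a)) x‖ ≤ ∫ x, ‖iteratedFDeriv ℝ k φ x‖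
    rw [iteratedFDeriv_comp_sub']
    exact (integral_sub_right_eq_self (fun x => ‖iteratedFDeriv ℝ k φ x‖) a).le

end SmoothL1

/-- A pointwise Leibniz bound for the product of an element of `AP^∞` and one of `𝒟_{L¹}`. -/
lemma leibniz_bound {N : ℕ} (u : APInfty N) (k : ℕ) (φ : SmoothL1 N) (x : Eu N) :
    ‖iteratedFDeriv ℝ k (fun y => u y * φ y) x‖ ≤ ∑ i ∈ Finset.range (k + 1),
      (k.choose i * APInfty.derivSup N i u) * ‖iteratedFDeriv ℝ (k - i) φ x‖ := by
  refine (norm_iteratedFDeriv_mul_le (N := k) (u.contDiff_nat k) (φ.contDiff_nat k) x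
    le_rfl).trans (Finset.sum_le_sum fun i _ => ?_)
  gcongr
  exact le_ciSup (u.bddAbove_deriv i) x

/-- Multiplication by `u ∈ AP^∞` on `𝒟_{L¹}`. -/
def mulTestLinear {N : ℕ} (u : APInfty N) : SmoothL1 N →ₗ[ℂ] SmoothL1 N where
  toFun φ := ⟨fun x => u x * φ x, u.contDiff.mul φ.2.1, fun k => by
    have hc : ContDiff ℝ k (fun x => u x * φ x) := (u.contDiff_nat k).mul (φ.contDiff_nat k)
    refine Integrable.mono' (g := fun x => ∑ i ∈ Finset.range (k + 1),
      (k.choose i * APInfty.derivSup N i u) * ‖iteratedFDeriv ℝ (k - i) φ x‖) ?_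
      (hc.continuous_iteratedFDeriv le_rfl).aestronglyMeasurable
      (Eventually.of_forall (leibniz_bound u k φ))
    exact integrable_finsetSum _ fun i _ => (φ.integrable_deriv _).norm.const_mul _⟩
  map_add' φ ψ := Subtype.ext (funext fun x => mul_add (u x) (φ x) (ψ x))
  map_smul' c φ := Subtype.ext (funext fun x => mul_left_comm (u x) c (φ x))

/-- Multiplication by `u ∈ AP^∞` on `𝒟_{L¹}`, as a continuous linear map. -/
def mulTest {N : ℕ} (u : APInfty N) : SmoothL1 N →L[ℂ] SmoothL1 N where
  toLinearMap := mulTestLinear u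
  cont := by
    refine WithSeminorms.continuous_of_isBounded (τ₁₂ := RingHom.id ℂ) (SmoothL1.withSeminorms N)
      (SmoothL1.withSeminorms N) (mulTestLinear u) fun k => ⟨Finset.range (k + 1),
        ∑ i ∈ Finset.range (k + 1), (k.choose i) * ⟨APInfty.derivSup N i u, apply_nonneg _ _⟩,
        fun φ => ?_⟩
    change ∫ x, ‖iteratedFDeriv ℝ k (fun y => u y * φ y) x‖ ≤ _
    have hint : ∀ i ∈ Finset.range (k + 1), Integrable (fun x =>
        (k.choose i * APInfty.derivSup N i u) * ‖iteratedFDeriv ℝ (k - i) φ x‖) volume :=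
      fun i _ => (φ.integrable_deriv _).norm.const_mul _
    refine (integral_mono_of_nonneg (Eventually.of_forall fun x => norm_nonneg _)
      (integrable_finsetSum _ hint) (Eventually.of_forall (leibniz_bound u k φ))).trans ?_
    rw [integral_finsetSum _ hint]
    simp only [integral_const_mul]
    change _ ≤ ((∑ i ∈ Finset.range (k + 1),
      (k.choose i : ℝ≥0) * ⟨APInfty.derivSup N i u, apply_nonneg _ _⟩ : ℝ≥0) : ℝ) * _
    rw [NNReal.coe_sum, Finset.sum_mul]
    refine Finset.sum_le_sum fun i _ => ?_
    refine mul_le_mul_of_nonneg_left ?_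
      (mul_nonneg (Nat.cast_nonneg _) (apply_nonneg _ _))
    exact Seminorm.le_finset_sup_apply (p := SmoothL1.norms N) (s := Finset.range (k + 1))
      (x := φ) (i := k - i) (Finset.mem_range.2 (by omega))

/-- The space `ℬ'_∞(ℝ^N)` of bounded distributions: the topological dual of `𝒟_{L¹}(ℝ^N)`. As
a space of continuous linear maps it carries the topology of uniform convergence on the bounded
subsets of `𝒟_{L¹}(ℝ^N)`, that is, the strong dual topology. -/
abbrev BoundedDistribution (N : ℕ) : Type := SmoothL1 N →L[ℂ] ℂ

/-- The translate of a distribution, `⟨τ_a T, φ⟩ = ⟨T, φ(· - a)⟩`. -/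
def distTranslate {N : ℕ} (a : Eu N) (T : BoundedDistribution N) : BoundedDistribution N :=
  T.comp (SmoothL1.shift a)

/-- The product of a bounded distribution with a function in `AP^∞`, `⟨uT, φ⟩ = ⟨T, uφ⟩`. -/
def distMul {N : ℕ} (u : APInfty N) (T : BoundedDistribution N) : BoundedDistribution N :=
  T.comp (mulTest u)

/-- The linear form `φ ↦ ∫ u φ` on `𝒟_{L¹}` given by `u ∈ AP^∞`. -/
def integralForm {N : ℕ} (u : APInfty N) : SmoothL1 N →ₗ[ℂ] ℂ where
  toFun φ := ∫ x, u x * φ x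
  map_add' φ ψ := by
    have h : ∀ φ : SmoothL1 N, Integrable (fun x => u x * φ x) volume :=
      fun φ => (mulTest u φ).integrable
    rw [← integral_add (h φ) (h ψ)]
    exact integral_congr_ae (Eventually.of_forall fun x => mul_add (u x) (φ x) (ψ x))
  map_smul' c φ := by
    rw [RingHom.id_apply, ← integral_smul]
    exact integral_congr_ae (Eventually.of_forall fun x => mul_left_comm (u x) c (φ x))

/-- The bounded distribution `φ ↦ ∫ u φ` associated with `u ∈ AP^∞`. -/
def distOfFun {N : ℕ} (u : APInfty N) : BoundedDistribution N where
  toLinearMap := integralForm u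
  cont := by
    have h0 : Continuous fun φ : SmoothL1 N => SmoothL1.norms N 0 (mulTest u φ) :=
      ((SmoothL1.withSeminorms N).continuous_seminorm 0).comp (mulTest u).continuous
    have h1 : Tendsto (fun φ : SmoothL1 N => SmoothL1.norms N 0 (mulTest u φ)) (𝓝 0) (𝓝 0) := by
      simpa using h0.tendsto 0
    change Continuous (integralForm u)
    refine continuous_of_continuousAt_zero (integralForm u) ?_
    rw [ContinuousAt, map_zero]
    refine squeeze_zero_norm (fun φ => ?_) h1
    refine (norm_integral_le_integral_norm _).trans (le_of_eq ?_)
    rw [SmoothL1.norms_apply]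
    refine integral_congr_ae (Eventually.of_forall fun x => ?_)
    simp only [norm_iteratedFDeriv_zero]
    rfl

/-- The space `ℬ'_AP(ℝ^N)` of almost periodic distributions: the bounded distributions whose set
of translates is relatively compact in `ℬ'_∞(ℝ^N)`, with the relative topology. -/
def apDistributions (N : ℕ) : Submodule ℂ (BoundedDistribution N) where
  carrier := {T | IsCompact (closure (Set.range fun a => distTranslate a T))}
  zero_mem' := by
    refine (isCompact_singleton (x := (0 : BoundedDistribution N))).closure_of_subset ?_
    rintro _ ⟨a, rfl⟩
    rfl
  add_mem' := by
    intro S T hS hT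
    refine (IsCompact.add hS hT).closure_of_subset ?_
    rintro _ ⟨a, rfl⟩
    exact Set.add_mem_add (subset_closure (Set.mem_range_self a))
      (subset_closure (Set.mem_range_self a))
  smul_mem' := by
    intro c T hT
    refine (IsCompact.smul c hT).closure_of_subset ?_
    rintro _ ⟨a, rfl⟩
    exact Set.smul_mem_smul_set (subset_closure (Set.mem_range_self a))

/-- `M` is a continuous linear form on `ℬ'_AP(ℝ^N)` which extends the mean value on
`AP^∞(ℝ^N)`. -/
def ExtendsMeanValue {N : ℕ} (M : apDistributions N →L[ℂ] ℂ) : Prop :=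
  ∀ u : APInfty N, ∃ h : distOfFun u ∈ apDistributions N, IsMeanValue u (M ⟨distOfFun u, h⟩)

/-! ### Besicovitch classes and the space `𝒟_AP` -/

/-- The average of `|u|` over the ball of radius `r` centred at the origin. -/
def ballAverage {N : ℕ} (u : Eu N → ℂ) (r : ℝ) : ℝ≥0∞ :=
  (volume (Metric.ball (0 : Eu N) r))⁻¹ * ∫⁻ y in Metric.ball (0 : Eu N) r, ‖u y‖ₑ

/-- The Besicovitch seminorm `‖u‖₁`. -/
def besicovitchNorm {N : ℕ} (u : Eu N → ℂ) : ℝ≥0∞ :=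
  limsup (fun r : ℝ => ballAverage u r) atTop

lemma besicovitchNorm_zero {N : ℕ} : besicovitchNorm (0 : Eu N → ℂ) = 0 := by
  simp [besicovitchNorm, ballAverage]

lemma besicovitchNorm_add_le {N : ℕ} {u v : Eu N → ℂ} (hu : LocallyIntegrable u volume) :
    besicovitchNorm (u + v) ≤ besicovitchNorm u + besicovitchNorm v := by
  refine ENNReal.le_of_forall_pos_le_add fun ε hε hfin => ?_
  obtain ⟨h1, h2⟩ := ENNReal.add_lt_top.1 hfin
  have hε' : (ε / 2 : ℝ≥0∞) ≠ 0 := by simpa using hε.ne'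
  have e1 := eventually_lt_of_limsup_lt (ENNReal.lt_add_right h1.ne hε')
  have e2 := eventually_lt_of_limsup_lt (ENNReal.lt_add_right h2.ne hε')
  refine limsup_le_of_le (h := ?_)
  filter_upwards [e1, e2] with r hr1 hr2
  calc ballAverage (u + v) r ≤ ballAverage u r + ballAverage v r := by
        unfold ballAverage
        rw [← mul_add, ← lintegral_add_left' hu.aestronglyMeasurable.enorm.restrict]
        gcongr with y
        exact enorm_add_le _ _
    _ ≤ (besicovitchNorm u + ε / 2) + (besicovitchNorm v + ε / 2) := add_le_add hr1.le hr2.le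
    _ = besicovitchNorm u + besicovitchNorm v + ε := by
        rw [add_add_add_comm, ENNReal.add_halves]

lemma besicovitchNorm_smul_le {N : ℕ} (c : ℂ) (u : Eu N → ℂ) :
    besicovitchNorm (c • u) ≤ ‖c‖ₑ * besicovitchNorm u := by
  have : ∀ r, ballAverage (c • u) r = ‖c‖ₑ * ballAverage u r := fun r => by
    unfold ballAverage
    simp only [Pi.smul_apply, enorm_smul]
    rw [lintegral_const_mul' _ _ enorm_ne_top, mul_left_comm]
  unfold besicovitchNorm
  simp only [this]
  rw [ENNReal.limsup_const_mul_of_ne_top enorm_ne_top]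

/-- The Besicovitch space `B¹_AP(ℝ^N)`: the closure of the almost periodic functions for the
Besicovitch seminorm. -/
def besicovitchSpace (N : ℕ) : Submodule ℂ (Eu N → ℂ) where
  carrier := {f | LocallyIntegrable f volume ∧
    ∀ ε : ℝ≥0∞, ε ≠ 0 → ∃ u : Eu N → ℂ, IsBohrAP u ∧ besicovitchNorm (f - u) ≤ ε}
  zero_mem' := ⟨locallyIntegrable_zero, fun ε _ => ⟨0, IsBohrAP.zero, by
    rw [sub_zero, besicovitchNorm_zero]; exact zero_le⟩⟩
  add_mem' := by
    rintro f g ⟨hf, hf'⟩ ⟨hg, hg'⟩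
    refine ⟨hf.add hg, fun ε hε => ?_⟩
    obtain ⟨u, hu, hu'⟩ := hf' (ε / 2) (by simpa using hε)
    obtain ⟨v, hv, hv'⟩ := hg' (ε / 2) (by simpa using hε)
    refine ⟨u + v, hu.add hv, ?_⟩
    rw [add_sub_add_comm]
    refine (besicovitchNorm_add_le (hf.sub hu.continuous.locallyIntegrable)).trans ?_
    exact (add_le_add hu' hv').trans (ENNReal.add_halves ε).le
  smul_mem' := by
    rintro c f ⟨hf, hf'⟩
    refine ⟨hf.smul c, fun ε hε => ?_⟩
    obtain ⟨u, hu, hu'⟩ := hf' (ε / ‖c‖ₑ) (by simp [hε])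
    refine ⟨c • u, hu.smul c, ?_⟩
    rw [← smul_sub]
    refine (besicovitchNorm_smul_le c _).trans ?_
    exact (mul_le_mul_right hu' _).trans ENNReal.mul_div_le

/-- The subspace `𝒩` of the functions in `B¹_AP(ℝ^N)` with Besicovitch seminorm zero. -/
def besicovitchNull (N : ℕ) : Submodule ℂ (besicovitchSpace N) where
  carrier := {f | besicovitchNorm (f : Eu N → ℂ) = 0}
  zero_mem' := besicovitchNorm_zero
  add_mem' := by
    intro f g hf hg
    have := besicovitchNorm_add_le (v := (g : Eu N → ℂ)) f.2.1
    rw [Set.mem_ofPred_eq] at hf hg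
    rw [hf, hg, add_zero] at this
    exact le_antisymm this (zero_le)
  smul_mem' := by
    intro c f hf
    have := besicovitchNorm_smul_le c (f : Eu N → ℂ)
    rw [Set.mem_ofPred_eq] at hf
    rw [hf, mul_zero] at this
    exact le_antisymm this (zero_le)

/-- The space `ℬ¹_AP(ℝ^N) = B¹_AP(ℝ^N) / 𝒩`. -/
abbrev BesicovitchClass (N : ℕ) : Type := besicovitchSpace N ⧸ besicovitchNull N

/-- The inclusion of `AP^∞(ℝ^N)` in `B¹_AP(ℝ^N)`. -/
def apInftyToBesicovitch (N : ℕ) : APInfty N →ₗ[ℂ] besicovitchSpace N where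
  toFun u := ⟨u, u.isBohrAP.continuous.locallyIntegrable, fun ε _ => ⟨u, u.isBohrAP, by
    rw [sub_self, besicovitchNorm_zero]; exact zero_le⟩⟩
  map_add' _ _ := rfl
  map_smul' _ _ := rfl

/-- The canonical map `ϱ(u) = u + 𝒩` restricted to `AP^∞(ℝ^N)`. -/
def rhoLinear (N : ℕ) : APInfty N →ₗ[ℂ] BesicovitchClass N :=
  (besicovitchNull N).mkQ ∘ₗ apInftyToBesicovitch N

/-- An almost periodic function with Besicovitch seminorm zero vanishes. -/
lemma IsBohrAP.eq_zero {N : ℕ} {u : Eu N → ℂ} (hu : IsBohrAP u) (h0 : besicovitchNorm u = 0) :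
    u = 0 := by
  by_contra hne
  obtain ⟨x₀, hx₀⟩ : ∃ x, u x ≠ 0 := Function.ne_iff.1 hne
  have hcont := hu.continuous
  obtain ⟨f, hfu, hf⟩ := hu
  set δ : ℝ := ‖u x₀‖ with hδ
  have hδ0 : 0 < δ := norm_pos_iff.2 hx₀
  obtain ⟨t, htsub, htfin, htcov⟩ := Metric.finite_approx_of_totallyBounded
    (hf.totallyBounded.subset subset_closure) (δ / 2) (by positivity)
  -- finitely many translations `c` such that every `y + c` meets a point where `u` is large
  obtain ⟨s, hs⟩ : ∃ s : Finset (Eu N), ∀ y, ∃ c ∈ s, δ / 2 ≤ ‖u (y + c)‖ := by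
    have htsub' : ∀ g : Eu N →ᵇ ℂ, ∃ a : Eu N, g ∈ t → bcfTranslate a f = g := fun g => by
      by_cases hg : g ∈ t
      · obtain ⟨a, ha⟩ := htsub hg
        exact ⟨a, fun _ => ha⟩
      · exact ⟨0, fun h => absurd h hg⟩
    choose a ha using htsub'
    refine ⟨htfin.toFinset.image fun g => x₀ - a g, fun y => ?_⟩
    obtain ⟨g, hg, hyg⟩ := Set.mem_iUnion₂.1 (htcov ⟨y, rfl⟩)
    refine ⟨x₀ - a g, Finset.mem_image.2 ⟨g, by simpa using hg, rfl⟩, ?_⟩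
    have h1 : dist (u (x₀ - a g + y)) (u x₀) < δ / 2 := by
      have h2 := (BoundedContinuousFunction.dist_coe_le_dist (f := bcfTranslate y f) (g := g)
        (x₀ - a g)).trans_lt hyg
      have h4 : g (x₀ - a g) = f (x₀ - a g + a g) :=
        (DFunLike.congr_fun (ha g hg) (x₀ - a g)).symm
      rw [h4] at h2
      change dist (f (x₀ - a g + y)) (f (x₀ - a g + a g)) < δ / 2 at h2
      rwa [sub_add_cancel, hfu] at h2
    rw [add_comm y]
    rw [dist_eq_norm] at h1
    have h3 := norm_sub_norm_le (u x₀) (u (x₀ - a g + y))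
    rw [norm_sub_rev] at h3
    linarith
  obtain ⟨R, hR⟩ : ∃ R : ℝ, ∀ c ∈ s, ‖c‖ ≤ R :=
    ⟨∑ c ∈ s, ‖c‖, fun c hc => Finset.single_le_sum (f := fun c => ‖c‖)
      (fun _ _ => norm_nonneg _) hc⟩
  have hball : ∀ r : ℝ, 0 < r → volume (Metric.ball (0 : Eu N) r) ≠ 0 ∧
      volume (Metric.ball (0 : Eu N) r) ≠ (⊤ : ℝ≥0∞) := fun r hr =>
    ⟨(Metric.measure_ball_pos _ _ hr).ne', measure_ball_lt_top.ne⟩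
  have hvol : ∀ r : ℝ, volume (Metric.ball (0 : Eu N) (2 * r)) =
      ENNReal.ofReal (2 ^ N) * volume (Metric.ball (0 : Eu N) r) := fun r => by
    simpa using Measure.addHaar_ball_mul_of_pos (volume : Measure (Eu N)) 0 two_pos r
  -- the averages of `u` stay bounded away from zero
  have key : ∀ r : ℝ, 0 < r → R ≤ r → ENNReal.ofReal (δ / 2) ≤
      (s.card : ℝ≥0∞) * (ENNReal.ofReal (2 ^ N) * ballAverage u (2 * r)) := by
    intro r hr hRr
    obtain ⟨hb0, hbt⟩ := hball r hr
    have hmeas : ∀ c : Eu N, Measurable fun y => ‖u (y + c)‖ₑ := fun c =>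
      (hcont.comp (continuous_id.add continuous_const)).enorm.measurable
    have h1 : ENNReal.ofReal (δ / 2) * volume (Metric.ball (0 : Eu N) r) ≤
        ∑ c ∈ s, ∫⁻ y in Metric.ball (0 : Eu N) r, ‖u (y + c)‖ₑ := by
      rw [← lintegral_finsetSum _ fun c _ => hmeas c, ← setLIntegral_const]
      refine lintegral_mono fun y => ?_
      obtain ⟨c, hc, hyc⟩ := hs y
      refine le_trans ?_ (Finset.single_le_sum (f := fun c => ‖u (y + c)‖ₑ)
        (fun _ _ => zero_le) hc)
      rw [← ofReal_norm]
      exact ENNReal.ofReal_le_ofReal hyc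
    have h2 : ∀ c ∈ s, ∫⁻ y in Metric.ball (0 : Eu N) r, ‖u (y + c)‖ₑ ≤
        ∫⁻ y in Metric.ball (0 : Eu N) (2 * r), ‖u y‖ₑ := fun c hc => by
      rw [← lintegral_indicator Metric.isOpen_ball.measurableSet,
        ← lintegral_indicator Metric.isOpen_ball.measurableSet,
        ← lintegral_add_right_eq_self (fun y => (Metric.ball (0 : Eu N) (2 * r)).indicator
          (fun y => ‖u y‖ₑ) y) c]
      refine lintegral_mono fun y => ?_
      by_cases hy : y ∈ Metric.ball (0 : Eu N) r
      · have hyc : y + c ∈ Metric.ball (0 : Eu N) (2 * r) := by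
          rw [mem_ball_zero_iff] at hy ⊢
          have := norm_add_le y c
          have := hR c hc
          linarith
        rw [Set.indicator_of_mem hy, Set.indicator_of_mem hyc]
      · rw [Set.indicator_of_notMem hy]
        exact zero_le
    have h3 : ENNReal.ofReal (δ / 2) * volume (Metric.ball (0 : Eu N) r) ≤
        (s.card : ℝ≥0∞) * ∫⁻ y in Metric.ball (0 : Eu N) (2 * r), ‖u y‖ₑ := by
      refine h1.trans ((Finset.sum_le_card_nsmul s _ _ h2).trans (by rw [nsmul_eq_mul]))
    have h4 : ENNReal.ofReal (2 ^ N) * ballAverage u (2 * r) =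
        (volume (Metric.ball (0 : Eu N) r))⁻¹ *
          ∫⁻ y in Metric.ball (0 : Eu N) (2 * r), ‖u y‖ₑ := by
      have hp : ENNReal.ofReal (2 ^ N) ≠ 0 := by simp
      unfold ballAverage
      rw [hvol, ENNReal.mul_inv (Or.inl hp) (Or.inl ENNReal.ofReal_ne_top), ← mul_assoc,
        ← mul_assoc, ENNReal.mul_inv_cancel hp ENNReal.ofReal_ne_top, one_mul]
    rw [h4, mul_left_comm, ← mul_comm _ (volume _)⁻¹, ← div_eq_mul_inv,
      ENNReal.le_div_iff_mul_le (Or.inl hb0) (Or.inl hbt)]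
    exact h3
  have hK : (s.card : ℝ≥0∞) * ENNReal.ofReal (2 ^ N) ≠ (⊤ : ℝ≥0∞) :=
    ENNReal.mul_ne_top (ENNReal.natCast_ne_top _) ENNReal.ofReal_ne_top
  have hlim : Tendsto (fun r => ballAverage u r) atTop (𝓝 0) :=
    tendsto_of_le_liminf_of_limsup_le (zero_le) h0.le
  have hlim2 : Tendsto (fun r : ℝ => (s.card : ℝ≥0∞) * ENNReal.ofReal (2 ^ N) *
      ballAverage u (2 * r)) atTop (𝓝 0) := by
    simpa using ENNReal.Tendsto.const_mul
      (hlim.comp (tendsto_id.const_mul_atTop (two_pos (α := ℝ)))) (Or.inr hK)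
  have hle : ENNReal.ofReal (δ / 2) ≤ 0 := by
    refine ge_of_tendsto hlim2 ?_
    filter_upwards [eventually_gt_atTop 0, eventually_ge_atTop R] with r hr hRr
    rw [mul_assoc]
    exact key r hr hRr
  have : δ / 2 ≤ 0 := by simpa using hle
  linarith

lemma rhoLinear_injective (N : ℕ) : Function.Injective (rhoLinear N) := by
  rw [← LinearMap.ker_eq_bot, LinearMap.ker_eq_bot']
  intro u hu
  have h : apInftyToBesicovitch N u ∈ besicovitchNull N :=
    (Submodule.Quotient.mk_eq_zero _).1 hu
  exact Subtype.ext (u.isBohrAP.eq_zero h)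

/-- The space `𝒟_AP(ℝ^N) = ϱ(AP^∞(ℝ^N))`, a subspace of `ℬ¹_AP(ℝ^N)`. -/
def DAP (N : ℕ) : Type := LinearMap.range (rhoLinear N)

namespace DAP

variable {N : ℕ}

instance : AddCommGroup (DAP N) := inferInstanceAs (AddCommGroup (LinearMap.range (rhoLinear N)))
instance : Module ℂ (DAP N) := inferInstanceAs (Module ℂ (LinearMap.range (rhoLinear N)))

/-- The canonical map `ϱ`, as a linear isomorphism of `AP^∞(ℝ^N)` onto `𝒟_AP(ℝ^N)`. -/
def rho (N : ℕ) : APInfty N ≃ₗ[ℂ] DAP N :=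
  LinearEquiv.ofInjective (rhoLinear N) (rhoLinear_injective N)

/-- The norms `N_n(ϱ(u)) = sup_{k ≤ n} sup_y ‖D^k u(y)‖`. -/
def norms (N : ℕ) : SeminormFamily ℂ (DAP N) ℕ :=
  fun n => (APInfty.norms N n).comp (rho N).symm.toLinearMap

instance : TopologicalSpace (DAP N) := (norms N).moduleFilterBasis.topology

lemma withSeminorms (N : ℕ) : WithSeminorms (norms N) := ⟨rfl⟩

instance : IsTopologicalAddGroup (DAP N) := (withSeminorms N).topologicalAddGroup
instance : ContinuousSMul ℂ (DAP N) := (withSeminorms N).continuousSMul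

end DAP

/-- The space `𝒟'_AP(ℝ^N)` of the distributions on `𝒟_AP(ℝ^N)`: the topological dual of
`𝒟_AP(ℝ^N)` with the strong dual topology. -/
abbrev DAPDual (N : ℕ) : Type := DAP N →L[ℂ] ℂ

end APDist

end

/-! Everything is reduced to the mean value of almost periodic functions. Convex combinations of
translations are commuting contractions which fix constants. A Markov–Kakutani argument on the
compact closed convex hull of the translates of `f` yields an invariant element, that is, a constant
(`exists_meanRel`). Commutation alone makes this constant unique and additive in `f`
(`MeanRel.add_eq`), and Hahn–Banach extends it to a continuous form `meanForm` on all bounded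
continuous functions.

For a bounded distribution `T` and a test function `θ`, let `evalBCF θ T` be the function `a ↦ ⟨T,
θ(· - a)⟩`. It depends continuously on `T`, commutes with translation, and is almost periodic when
`T` is. If `T` is a function `f`, its mean is `𝔐(f) ∫ θ`, so with `∫ θ = 1` the mean of `evalBCF θ
T` extends `𝔐` (`meanDist`). This extension is unique because `AP^∞` is dense: convolving `T` twice
with an even mollifier gives an element of `AP^∞`, and tends to `T` uniformly on bounded sets of
test functions (`exists_seq_tendsto_distOfFun`). As `ℬ'_AP` is closed, density also gives its
stability under multiplication by `AP^∞`.

`Φ` is continuous because the products of a bounded subset of `𝒟_AP` with all translates of one test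
function form a bounded subset of `𝒟_{L¹}`.

For injectivity, `𝔐((f * θ) T) = 𝔐(f · evalBCF θ T)` holds on functions by translation invariance
and in general by density. With `f` the conjugate of `g = evalBCF θ T`, the hypothesis `Φ(T) = 0`
gives `𝔐(|g|²) = 0`, hence `g = 0`. This for all `θ` of compact support forces `T = 0` by
mollification. -/

noncomputable section

namespace APDist

/-! ### Averages of translates and the mean value of almost periodic functions. -/

section Mean

variable {N : ℕ}

/-- Translation of bounded continuous functions, as a continuous linear map. -/
def translCLM (a : Eu N) : (Eu N →ᵇ ℂ) →L[ℂ] (Eu N →ᵇ ℂ) :=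
  LinearMap.mkContinuous
    { toFun := bcfTranslate a
      map_add' := fun _ _ => rfl
      map_smul' := fun _ _ => rfl } 1
    fun f => by
      rw [one_mul]
      exact (BoundedContinuousFunction.norm_le (norm_nonneg _)).2 fun x => f.norm_coe_le_norm _

@[simp] lemma translCLM_apply (a : Eu N) (f : Eu N →ᵇ ℂ) : translCLM a f = bcfTranslate a f := rfl

@[simp] lemma bcfTranslate_apply {F : Type*} [NormedAddCommGroup F] (a : Eu N) (f : Eu N →ᵇ F)
    (x : Eu N) : bcfTranslate a f x = f (x + a) := rfl

lemma bcfTranslate_comm {F : Type*} [NormedAddCommGroup F] (a b : Eu N) (f : Eu N →ᵇ F) :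
    bcfTranslate a (bcfTranslate b f) = bcfTranslate (a + b) f := by
  ext x
  simp [add_assoc]

lemma norm_translCLM_le (a : Eu N) : ‖(translCLM a : (Eu N →ᵇ ℂ) →L[ℂ] (Eu N →ᵇ ℂ))‖ ≤ 1 :=
  LinearMap.mkContinuous_norm_le _ zero_le_one _

/-- The convex hull of the translation operators. -/
def averagingOps (N : ℕ) : Set ((Eu N →ᵇ ℂ) →L[ℂ] (Eu N →ᵇ ℂ)) :=
  convexHull ℝ (Set.range translCLM)

lemma averagingOps_norm_apply_le {P : (Eu N →ᵇ ℂ) →L[ℂ] (Eu N →ᵇ ℂ)} (hP : P ∈ averagingOps N)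
    (f : Eu N →ᵇ ℂ) : ‖P f‖ ≤ ‖f‖ := by
  have h : averagingOps N ⊆ Metric.closedBall 0 1 := by
    refine convexHull_min ?_ (convex_closedBall _ _)
    rintro _ ⟨a, rfl⟩
    simpa using norm_translCLM_le a
  have h1 : ‖P‖ ≤ 1 := by simpa using h hP
  exact (P.le_opNorm f).trans (mul_le_of_le_one_left (norm_nonneg _) h1)

lemma averagingOps_const {P : (Eu N →ᵇ ℂ) →L[ℂ] (Eu N →ᵇ ℂ)} (hP : P ∈ averagingOps N) (c : ℂ) :
    P (BoundedContinuousFunction.const (Eu N) c) = BoundedContinuousFunction.const (Eu N) c := by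
  have h : averagingOps N ⊆ {P | P (BoundedContinuousFunction.const (Eu N) c) =
      BoundedContinuousFunction.const (Eu N) c} := by
    refine convexHull_min ?_ ?_
    · rintro _ ⟨a, rfl⟩
      rfl
    · intro P hP Q hQ s t _ _ hst
      simp only [Set.mem_ofPred_eq, add_apply, smul_apply] at *
      rw [hP, hQ, ← add_smul, hst, one_smul]
  exact h hP

/-- Translations commute, and commuting with a fixed operator is a convex condition; it therefore
passes to the hull in one factor and then in the other. -/
lemma averagingOps_comm {P Q : (Eu N →ᵇ ℂ) →L[ℂ] (Eu N →ᵇ ℂ)} (hP : P ∈ averagingOps N)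
    (hQ : Q ∈ averagingOps N) : P * Q = Q * P := by
  have aux : ∀ R : (Eu N →ᵇ ℂ) →L[ℂ] (Eu N →ᵇ ℂ), Convex ℝ {P | P * R = R * P} := by
    intro R A hA B hB s t _ _ _
    have hA' : ∀ f, A (R f) = R (A f) := DFunLike.congr_fun hA
    have hB' : ∀ f, B (R f) = R (B f) := DFunLike.congr_fun hB
    refine ContinuousLinearMap.ext fun f => ?_
    change s • A (R f) + t • B (R f) = R (s • A f + t • B f)
    rw [map_add, R.map_smul_of_tower, R.map_smul_of_tower, hA', hB']
  have h1 : ∀ a, averagingOps N ⊆ {P | P * translCLM a = translCLM a * P} := fun a => by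
    refine convexHull_min ?_ (aux _)
    rintro _ ⟨b, rfl⟩
    ext f x
    simp only [mul_apply_eq_comp, translCLM_apply, bcfTranslate_comm, add_comm]
  have h2 : averagingOps N ⊆ {R | R * P = P * R} := by
    refine convexHull_min ?_ (aux _)
    rintro _ ⟨b, rfl⟩
    exact (h1 b hP).symm
  exact (h2 hQ).symm

lemma averagingOps_mul_mem {P Q : (Eu N →ᵇ ℂ) →L[ℂ] (Eu N →ᵇ ℂ)} (hP : P ∈ averagingOps N)
    (hQ : Q ∈ averagingOps N) : P * Q ∈ averagingOps N := by
  have h1 : ∀ b, averagingOps N ⊆ {P | P * translCLM b ∈ averagingOps N} := fun b => by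
    refine convexHull_min ?_ fun A hA B hB s t hs ht hst =>
      convex_convexHull ℝ _ hA hB hs ht hst
    rintro _ ⟨a, rfl⟩
    refine subset_convexHull ℝ _ ⟨a + b, ContinuousLinearMap.ext fun f => ?_⟩
    exact (bcfTranslate_comm a b f).symm
  have h2 : averagingOps N ⊆ {Q | P * Q ∈ averagingOps N} := by
    refine convexHull_min ?_ fun A hA B hB s t hs ht hst => ?_
    · rintro _ ⟨b, rfl⟩
      exact h1 b hP
    · have : P * (s • A + t • B) = s • (P * A) + t • (P * B) := by
        refine ContinuousLinearMap.ext fun f => ?_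
        change P (s • A f + t • B f) = s • P (A f) + t • P (B f)
        rw [map_add, P.map_smul_of_tower, P.map_smul_of_tower]
      rw [Set.mem_ofPred_eq, this]
      exact convex_convexHull ℝ _ hA hB hs ht hst
  exact h2 hQ

/-- The average of the first `n` iterates of a translation. -/
lemma exists_averagingOps_invariant (a : Eu N) {n : ℕ} (hn : 0 < n) :
    ∃ P ∈ averagingOps N, ∀ f : Eu N →ᵇ ℂ,
      ‖bcfTranslate a (P f) - P f‖ ≤ (n : ℝ)⁻¹ * (2 * ‖f‖) := by
  refine ⟨∑ k ∈ Finset.range n, (n : ℝ)⁻¹ • translCLM ((k : ℝ) • a), ?_, fun f => ?_⟩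
  · refine (convex_convexHull ℝ _).sum_mem (fun _ _ => by positivity) ?_
      fun k _ => subset_convexHull ℝ _ ⟨_, rfl⟩
    simp [hn.ne']
  · have h : ∀ g : Eu N →ᵇ ℂ, (∑ k ∈ Finset.range n, (n : ℝ)⁻¹ • translCLM ((k : ℝ) • a)) g =
        (n : ℝ)⁻¹ • ∑ k ∈ Finset.range n, bcfTranslate ((k : ℝ) • a) g := fun g => by
      rw [sum_apply, Finset.smul_sum]
      rfl
    rw [h, ← translCLM_apply, ContinuousLinearMap.map_smul_of_tower, ← smul_sub, map_sum,
      ← Finset.sum_sub_distrib]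
    have h2 : ∀ k : ℕ, translCLM a (bcfTranslate ((k : ℝ) • a) f) =
        bcfTranslate (((k + 1 : ℕ) : ℝ) • a) f := fun k => by
      rw [translCLM_apply, bcfTranslate_comm]
      congr 1
      push_cast
      module
    simp only [h2]
    -- The sum telescopes: only the translates by `n • a` and by `0` survive, each of norm at most
    -- `‖f‖`.
    rw [Finset.sum_range_sub fun k : ℕ => bcfTranslate ((k : ℝ) • a) f, norm_smul, norm_inv,
      Real.norm_natCast, two_mul]
    gcongr
    refine (norm_sub_le _ _).trans (add_le_add ?_ ?_) <;>
    exact (BoundedContinuousFunction.norm_le (norm_nonneg _)).2 fun x => f.norm_coe_le_norm _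

/-- Points of the hull become values `P f` of operators, which can be composed and applied to other
functions. -/
lemma image_averagingOps (f : Eu N →ᵇ ℂ) :
    (fun P : (Eu N →ᵇ ℂ) →L[ℂ] (Eu N →ᵇ ℂ) => P f) '' averagingOps N =
      convexHull ℝ (Set.range fun a => bcfTranslate a f) := by
  have := LinearMap.image_convexHull (𝕜 := ℝ)
    ((ContinuousLinearMap.apply ℂ (Eu N →ᵇ ℂ) f).toLinearMap.restrictScalars ℝ)
    (Set.range (translCLM (N := N)))
  rw [← Set.range_comp] at this
  exact this

/-- `const c` is approximated by averages of translates of `f`. -/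
def MeanRel (f : Eu N →ᵇ ℂ) (c : ℂ) : Prop :=
  BoundedContinuousFunction.const (Eu N) c ∈
    closure (convexHull ℝ (Set.range fun a => bcfTranslate a f))

lemma isMeanValue_coe_iff {f : Eu N →ᵇ ℂ} {c : ℂ} : IsMeanValue f c ↔ MeanRel f c := by
  constructor
  · rintro ⟨g, hg, h⟩
    rwa [DFunLike.coe_injective hg] at h
  · exact fun h => ⟨f, rfl, h⟩

lemma meanRel_iff {f : Eu N →ᵇ ℂ} {c : ℂ} : MeanRel f c ↔
    ∀ ε > 0, ∃ P ∈ averagingOps N, ‖P f - BoundedContinuousFunction.const (Eu N) c‖ < ε := by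
  rw [MeanRel, Metric.mem_closure_iff]
  simp only [← image_averagingOps, Set.exists_mem_image, dist_comm, dist_eq_norm]

/-- If `P f`, `Q g`, `R (f + g)` are close to `c`, `d`, `e`, then the single operator `PQR` brings
`f`, `g`, `f + g` close to them simultaneously, because the averages commute, contract and fix
constants. Existence of `e` is assumed, not proved; `g = 0` then gives uniqueness of the mean. -/
lemma MeanRel.add_eq {f g : Eu N →ᵇ ℂ} {c d e : ℂ} (hf : MeanRel f c) (hg : MeanRel g d)
    (h : MeanRel (f + g) e) : e = c + d := by
  rw [meanRel_iff] at *
  refine eq_of_forall_dist_le fun ε hε => ?_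
  obtain ⟨P, hP, hPf⟩ := hf (ε / 3) (by positivity)
  obtain ⟨Q, hQ, hQg⟩ := hg (ε / 3) (by positivity)
  obtain ⟨R, hR, hRfg⟩ := h (ε / 3) (by positivity)
  have e1 : R (Q (P f)) - BoundedContinuousFunction.const (Eu N) c =
      R (Q (P f - BoundedContinuousFunction.const (Eu N) c)) := by
    rw [map_sub, map_sub, averagingOps_const hQ, averagingOps_const hR]
  have e2 : R (P (Q g)) - BoundedContinuousFunction.const (Eu N) d =
      R (P (Q g - BoundedContinuousFunction.const (Eu N) d)) := by
    rw [map_sub, map_sub, averagingOps_const hP, averagingOps_const hR]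
  have e3 : P (Q (R (f + g))) - BoundedContinuousFunction.const (Eu N) e =
      P (Q (R (f + g) - BoundedContinuousFunction.const (Eu N) e)) := by
    rw [map_sub, map_sub, averagingOps_const hQ, averagingOps_const hP]
  have e4 : P (Q (R (f + g))) = R (Q (P f)) + R (P (Q g)) := by
    have hPQ : ∀ x, P (Q x) = Q (P x) := fun x =>
      DFunLike.congr_fun (averagingOps_comm hP hQ) x
    have hPR : ∀ x, P (R x) = R (P x) := fun x =>
      DFunLike.congr_fun (averagingOps_comm hP hR) x
    have hQR : ∀ x, Q (R x) = R (Q x) := fun x =>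
      DFunLike.congr_fun (averagingOps_comm hQ hR) x
    rw [hQR, hPR, ← map_add R, hPQ, hPQ g, ← map_add Q, ← map_add P]
  have n1 := (averagingOps_norm_apply_le hR _).trans (averagingOps_norm_apply_le hQ
    (P f - BoundedContinuousFunction.const (Eu N) c))
  have n2 := (averagingOps_norm_apply_le hR _).trans (averagingOps_norm_apply_le hP
    (Q g - BoundedContinuousFunction.const (Eu N) d))
  have n3 := (averagingOps_norm_apply_le hP _).trans (averagingOps_norm_apply_le hQ
    (R (f + g) - BoundedContinuousFunction.const (Eu N) e))
  rw [← e1] at n1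
  rw [← e2] at n2
  rw [← e3, e4] at n3
  set u := R (Q (P f)) with hu
  set v := R (P (Q g)) with hv
  have m1 := ((u - BoundedContinuousFunction.const (Eu N) c).norm_coe_le_norm 0).trans n1
  have m2 := ((v - BoundedContinuousFunction.const (Eu N) d).norm_coe_le_norm 0).trans n2
  have m3 := ((u + v - BoundedContinuousFunction.const (Eu N) e).norm_coe_le_norm 0).trans n3
  simp only [BoundedContinuousFunction.coe_sub, BoundedContinuousFunction.coe_add,
    Pi.sub_apply, Pi.add_apply, BoundedContinuousFunction.const_apply] at m1 m2 m3
  have : e - (c + d) = (u 0 - c) + (v 0 - d) - (u 0 + v 0 - e) := by ring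
  rw [dist_eq_norm, this]
  have t1 := norm_sub_le ((u 0 - c) + (v 0 - d)) (u 0 + v 0 - e)
  have t2 := norm_add_le (u 0 - c) (v 0 - d)
  linarith

lemma MeanRel.const (c : ℂ) : MeanRel (BoundedContinuousFunction.const (Eu N) c) c :=
  subset_closure (subset_convexHull ℝ _ ⟨0, rfl⟩)

lemma MeanRel.unique {f : Eu N →ᵇ ℂ} {c d : ℂ} (hf : MeanRel f c) (hg : MeanRel f d) : c = d := by
  have h0 : MeanRel (0 : Eu N →ᵇ ℂ) 0 := MeanRel.const 0
  have := hg.add_eq h0 (e := c) (by rwa [add_zero])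
  rwa [add_zero] at this

lemma MeanRel.smul {f : Eu N →ᵇ ℂ} {c : ℂ} (k : ℂ) (hf : MeanRel f c) :
    MeanRel (k • f) (k * c) := by
  rw [meanRel_iff] at *
  intro ε hε
  obtain ⟨P, hP, h⟩ := hf (ε / (‖k‖ + 1)) (by positivity)
  refine ⟨P, hP, ?_⟩
  have : P (k • f) - BoundedContinuousFunction.const (Eu N) (k * c) =
      k • (P f - BoundedContinuousFunction.const (Eu N) c) := by
    rw [map_smul, smul_sub]
    rfl
  rw [this, norm_smul]
  rw [lt_div_iff₀ (by positivity)] at h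
  nlinarith [norm_nonneg (P f - BoundedContinuousFunction.const (Eu N) c)]

/-- The source of all estimates on the mean: balls give the norm bound, half-spaces give positivity,
preimages give compatibility with operators. -/
lemma MeanRel.mem_of_convex {f : Eu N →ᵇ ℂ} {c : ℂ} (hf : MeanRel f c) {s : Set (Eu N →ᵇ ℂ)}
    (hs : Convex ℝ s) (hc : IsClosed s) (h : ∀ a, bcfTranslate a f ∈ s) :
    BoundedContinuousFunction.const (Eu N) c ∈ s := by
  refine closure_minimal (convexHull_min ?_ hs) hc hf
  rintro _ ⟨a, rfl⟩
  exact h a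

lemma MeanRel.norm_le {f : Eu N →ᵇ ℂ} {c : ℂ} (hf : MeanRel f c) : ‖c‖ ≤ ‖f‖ := by
  have := hf.mem_of_convex (convex_closedBall (0 : Eu N →ᵇ ℂ) ‖f‖) Metric.isClosed_closedBall
    fun a => by
      rw [mem_closedBall_zero_iff]
      exact (BoundedContinuousFunction.norm_le (norm_nonneg _)).2 fun x => f.norm_coe_le_norm _
  rw [mem_closedBall_zero_iff] at this
  exact (BoundedContinuousFunction.norm_coe_le_norm
    (BoundedContinuousFunction.const (Eu N) c) 0).trans this

lemma MeanRel.translate {f : Eu N →ᵇ ℂ} {c : ℂ} (hf : MeanRel f c) (a : Eu N) :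
    MeanRel (bcfTranslate a f) c := by
  have : (Set.range fun b => bcfTranslate b (bcfTranslate a f)) =
      Set.range fun b => bcfTranslate b f := by
    simp only [bcfTranslate_comm]
    exact (Equiv.addRight a).surjective.range_comp fun b => bcfTranslate b f
  rwa [MeanRel, this]

/-- The submodule of the almost periodic functions in the space of bounded continuous functions. -/
def apBCF (N : ℕ) : Submodule ℂ (Eu N →ᵇ ℂ) where
  carrier := {f | IsBohrAP f}
  zero_mem' := IsBohrAP.zero
  add_mem' := fun hf hg => hf.add hg
  smul_mem' := fun c _ hf => hf.smul c

lemma isBohrAP_coe_iff {F : Type*} [NormedAddCommGroup F] {f : Eu N →ᵇ F} :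
    IsBohrAP f ↔ IsCompact (closure (Set.range fun a => bcfTranslate a f)) := by
  constructor
  · rintro ⟨g, hg, h⟩
    rwa [DFunLike.coe_injective hg] at h
  · exact fun h => ⟨f, rfl, h⟩

/-- Existence of the mean value, by the Markov–Kakutani argument. -/
lemma exists_meanRel {f : Eu N →ᵇ ℂ} (hf : IsBohrAP f) : ∃ c, MeanRel f c := by
  rw [isBohrAP_coe_iff] at hf
  set K := closure (convexHull ℝ (Set.range fun a => bcfTranslate a f)) with hK
  have hKc : IsCompact K :=
    ((hf.totallyBounded.subset subset_closure).convexHull.closure).isCompact_of_isClosed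
      isClosed_closure
  have hKne : K.Nonempty := ⟨f, subset_closure (subset_convexHull ℝ _ ⟨0, by ext; simp⟩)⟩
  have hKconv : Convex ℝ K := (convex_convexHull ℝ _).closure
  have hKt : ∀ P ∈ averagingOps N, Set.MapsTo P K K := by
    intro P hP
    have hT : ∀ a, Set.MapsTo (translCLM (N := N) a) K K := fun a => by
      refine Set.MapsTo.closure ?_ (translCLM a).continuous
      rw [Set.mapsTo_iff_image_subset]
      refine (((translCLM (N := N) a).toLinearMap.restrictScalars ℝ).image_convexHull
        (Set.range fun a => bcfTranslate a f)).trans_subset (convexHull_mono ?_)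
      rintro _ ⟨_, ⟨b, rfl⟩, rfl⟩
      exact ⟨a + b, (bcfTranslate_comm a b f).symm⟩
    intro g hg
    have : averagingOps N ⊆ {P | P g ∈ K} := by
      refine convexHull_min ?_ ?_
      · rintro _ ⟨a, rfl⟩
        exact hT a hg
      · intro A hA B hB s t hs ht hst
        exact hKconv hA hB hs ht hst
    exact this hP
  -- The compact sets `P(K)` are directed downwards: `PQ(K) = QP(K)` lies in both `P(K)` and `Q(K)`.
  -- Hence they have a common point `g`.
  obtain ⟨g, hg⟩ : (⋂ P : averagingOps N, P.1 '' K).Nonempty := by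
    have : Nonempty (averagingOps N) := ⟨⟨translCLM 0, subset_convexHull ℝ _ ⟨0, rfl⟩⟩⟩
    refine IsCompact.nonempty_iInter_of_directed_nonempty_isCompact_isClosed _ ?_
      (fun P => hKne.image _) (fun P => hKc.image P.1.continuous)
      fun P => (hKc.image P.1.continuous).isClosed
    intro P Q
    refine ⟨⟨P.1 * Q.1, averagingOps_mul_mem P.2 Q.2⟩, ?_, ?_⟩
    · rintro _ ⟨x, hx, rfl⟩
      exact ⟨Q.1 x, hKt Q.1 Q.2 hx, rfl⟩
    · rintro _ ⟨x, hx, rfl⟩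
      refine ⟨P.1 x, hKt P.1 P.2 hx, ?_⟩
      exact (DFunLike.congr_fun (averagingOps_comm P.2 Q.2) x).symm
  rw [Set.mem_iInter] at hg
  obtain ⟨R, hR⟩ := hKc.isBounded.exists_norm_le
  -- For each `n`, `g` is the average of some `y ∈ K` over `n` multiples of `a`, so translation by
  -- `a` moves it by at most `2R / n`.
  have hinv : ∀ a, bcfTranslate a g = g := by
    intro a
    rw [← sub_eq_zero, ← norm_le_zero_iff]
    have hlim : Tendsto (fun n : ℕ => (n : ℝ)⁻¹ * (2 * R)) atTop (𝓝 0) := by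
      simpa using (tendsto_inv_atTop_nhds_zero_nat (𝕜 := ℝ)).mul_const (2 * R)
    refine ge_of_tendsto hlim ?_
    filter_upwards [eventually_gt_atTop 0] with n hn
    obtain ⟨P, hP, h⟩ := exists_averagingOps_invariant a hn
    obtain ⟨y, hy, rfl⟩ := hg ⟨P, hP⟩
    refine (h y).trans ?_
    gcongr
    exact hR y hy
  have hconst : BoundedContinuousFunction.const (Eu N) (g 0) = g := by
    ext a
    have := DFunLike.congr_fun (hinv a) 0
    rw [bcfTranslate_apply, zero_add] at this
    exact this.symm
  refine ⟨g 0, ?_⟩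
  rw [MeanRel, hconst]
  obtain ⟨y, hy, hyg⟩ := hg ⟨translCLM 0, subset_convexHull ℝ _ ⟨0, rfl⟩⟩
  rw [← hyg]
  exact hKt _ (subset_convexHull ℝ _ ⟨0, rfl⟩) hy

/-- A continuous linear form on the bounded continuous functions whose value at an almost periodic
function is its mean value. -/
lemma exists_meanForm (N : ℕ) : ∃ m : (Eu N →ᵇ ℂ) →L[ℂ] ℂ,
    ∀ f : Eu N →ᵇ ℂ, IsBohrAP f → MeanRel f (m f) := by
  choose! c hc using fun (f : Eu N →ᵇ ℂ) (hf : IsBohrAP f) => exists_meanRel hf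
  let m₀ : apBCF N →L[ℂ] ℂ := LinearMap.mkContinuous
    { toFun := fun f => c f
      map_add' := fun f g => (hc f f.2).add_eq (hc g g.2) (hc (f + g) (f + g).2)
      map_smul' := fun k f => (hc (k • f) (k • f).2).unique ((hc f f.2).smul k) } 1
    fun f => by
      rw [one_mul]
      exact (hc f f.2).norm_le
  -- The values off the almost periodic functions carry no meaning; the extension serves to compose
  -- with maps and Bochner integrals on the whole Banach space.
  obtain ⟨m, hm, -⟩ := exists_extension_norm_eq (apBCF N) m₀
  refine ⟨m, fun f hf => ?_⟩
  have := hm ⟨f, hf⟩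
  change m f = c f at this
  rw [this]
  exact hc f hf

/-- The mean value, extended to a continuous linear form on the bounded continuous functions. -/
def meanForm (N : ℕ) : (Eu N →ᵇ ℂ) →L[ℂ] ℂ := (exists_meanForm N).choose

lemma meanRel_meanForm {f : Eu N →ᵇ ℂ} (hf : IsBohrAP f) : MeanRel f (meanForm N f) :=
  (exists_meanForm N).choose_spec f hf

lemma IsBohrAP.translate {F : Type*} [NormedAddCommGroup F] {f : Eu N →ᵇ F} (hf : IsBohrAP f)
    (a : Eu N) : IsBohrAP (bcfTranslate a f) := by
  rw [isBohrAP_coe_iff] at *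
  refine hf.closure_of_subset ?_
  rintro _ ⟨b, rfl⟩
  exact subset_closure ⟨b + a, (bcfTranslate_comm b a f).symm⟩

lemma meanForm_translate {f : Eu N →ᵇ ℂ} (hf : IsBohrAP f) (a : Eu N) :
    meanForm N (bcfTranslate a f) = meanForm N f :=
  (meanRel_meanForm (hf.translate a)).unique ((meanRel_meanForm hf).translate a)

/-- An additive map on bounded continuous functions which commutes with translations preserves
almost periodicity. -/
lemma IsBohrAP.map {F G : Type*} [NormedAddCommGroup F] [NormedAddCommGroup G] {f : Eu N →ᵇ F}
    (hf : IsBohrAP f) {A : (Eu N →ᵇ F) → (Eu N →ᵇ G)} (hA : Continuous A)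
    (h : ∀ a, A (bcfTranslate a f) = bcfTranslate a (A f)) : IsBohrAP (A f) := by
  rw [isBohrAP_coe_iff] at *
  refine (hf.image hA).closure_of_subset ?_
  rintro _ ⟨a, rfl⟩
  exact ⟨_, subset_closure ⟨a, rfl⟩, h a⟩

lemma IsBohrAP.mul {f g : Eu N →ᵇ ℂ} (hf : IsBohrAP f) (hg : IsBohrAP g) :
    IsBohrAP (f * g : Eu N →ᵇ ℂ) := by
  rw [isBohrAP_coe_iff] at *
  refine (hf.mul hg).closure_of_subset ?_
  rintro _ ⟨a, rfl⟩
  exact Set.mul_mem_mul (subset_closure (Set.mem_range_self a))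
    (subset_closure (Set.mem_range_self a))

lemma IsBohrAP.conj {f : Eu N →ᵇ ℂ} (hf : IsBohrAP f) : IsBohrAP (star f : Eu N →ᵇ ℂ) :=
  hf.map continuous_star fun _ => rfl

/-- Finitely many translates of an almost periodic function cannot all be small at one point. -/
lemma IsBohrAP.exists_finset_translates {f : Eu N →ᵇ ℂ} (hf : IsBohrAP f) (x₀ : Eu N) {δ : ℝ}
    (hδ : 0 < δ) : ∃ s : Finset (Eu N), ∀ y, ∃ c ∈ s, dist (f (y + c)) (f x₀) < δ := by
  rw [isBohrAP_coe_iff] at hf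
  obtain ⟨t, htsub, htfin, htcov⟩ := Metric.finite_approx_of_totallyBounded
    (hf.totallyBounded.subset subset_closure) δ hδ
  choose! a ha using fun g (hg : g ∈ t) => htsub hg
  refine ⟨htfin.toFinset.image fun g => x₀ - a g, fun y => ?_⟩
  obtain ⟨g, hg, hyg⟩ := Set.mem_iUnion₂.1 (htcov ⟨y, rfl⟩)
  refine ⟨x₀ - a g, Finset.mem_image.2 ⟨g, by simpa using hg, rfl⟩, ?_⟩
  -- The translate of `f` by `y` is uniformly `δ`-close to the translate by `a g`; at the point `x₀
  -- - a g` the latter takes the value `f x₀`.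
  have h2 := (BoundedContinuousFunction.dist_coe_le_dist (f := bcfTranslate y f) (g := g)
    (x₀ - a g)).trans_lt hyg
  have h4 : g (x₀ - a g) = f (x₀ - a g + a g) :=
    (DFunLike.congr_fun (ha g hg) (x₀ - a g)).symm
  rwa [h4, bcfTranslate_apply, sub_add_cancel, add_comm _ y] at h2

/-- An almost periodic function `f` with `𝔐(|f|²) = 0` vanishes. -/
lemma IsBohrAP.eq_zero_of_meanForm_star_mul {f : Eu N →ᵇ ℂ} (hf : IsBohrAP f)
    (h0 : meanForm N (star f * f) = 0) : f = 0 := by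
  have hq : IsBohrAP (star f * f : Eu N →ᵇ ℂ) := hf.conj.mul hf
  have hval : ∀ x, (star f * f : Eu N →ᵇ ℂ) x = ((‖f x‖ ^ 2 : ℝ) : ℂ) := fun x => by
    change star (f x) * f x = _
    rw [Complex.star_def, Complex.conj_mul']
    push_cast
    rfl
  by_contra hne
  obtain ⟨x₀, hx₀⟩ : ∃ x, f x ≠ 0 := by
    by_contra! h
    exact hne (BoundedContinuousFunction.ext h)
  set δ : ℝ := ‖f x₀‖ ^ 2 with hδ
  have hδ0 : 0 < δ := by positivity
  obtain ⟨s, hs⟩ := hq.exists_finset_translates x₀ (half_pos hδ0)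
  -- `F` still has mean zero, yet it is bounded below by `δ / 2` everywhere: at each point one of
  -- the translates of `|f|²` is within `δ / 2` of `|f x₀|² = δ`, and the others are nonnegative.
  set F : Eu N →ᵇ ℂ := ∑ c ∈ s, bcfTranslate c (star f * f) with hF
  have hFap : IsBohrAP F := (apBCF N).sum_mem fun c _ => hq.translate c
  have hFm : meanForm N F = 0 := by
    rw [hF, map_sum]
    exact Finset.sum_eq_zero fun c _ => (meanForm_translate hq c).trans h0
  have hFre : ∀ y, δ / 2 ≤ (F y).re := fun y => by
    have h1 : (F y).re = ∑ c ∈ s, ‖f (y + c)‖ ^ 2 := by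
      rw [hF, BoundedContinuousFunction.coe_sum, Finset.sum_apply, Complex.re_sum]
      refine Finset.sum_congr rfl fun c _ => ?_
      rw [bcfTranslate_apply, hval, Complex.ofReal_re]
    rw [h1]
    obtain ⟨c, hc, hyc⟩ := hs y
    refine le_trans ?_ (Finset.single_le_sum (f := fun c => ‖f (y + c)‖ ^ 2)
      (fun _ _ => by positivity) hc)
    rw [hval, hval, dist_eq_norm, ← Complex.ofReal_sub, Complex.norm_real, Real.norm_eq_abs,
      abs_lt] at hyc
    linarith [hyc.1]
  have hmem := (meanRel_meanForm hFap).mem_of_convex (s := {g | δ / 2 ≤ (g 0).re})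
    (fun g hg h hh a b ha hb hab => by
      change δ / 2 ≤ (a • g 0 + b • h 0).re
      simp only [Set.mem_ofPred_eq] at hg hh
      rw [Complex.add_re, Complex.smul_re, Complex.smul_re, smul_eq_mul, smul_eq_mul]
      nlinarith)
    (isClosed_le continuous_const
      (Complex.continuous_re.comp (BoundedContinuousFunction.evalCLM ℂ (0 : Eu N)).continuous))
    fun a => hFre _
  rw [hFm] at hmem
  have : δ / 2 ≤ 0 := by simpa using hmem
  linarith

end Mean

/-! ### Translation in `𝒟_{L¹}`. -/

section SmoothL1Facts

variable {N : ℕ}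

lemma SmoothL1.ext' {φ ψ : SmoothL1 N} (h : ∀ x, φ x = ψ x) : φ = ψ := Subtype.ext (funext h)

lemma SmoothL1.shift_shift (a b : Eu N) (φ : SmoothL1 N) :
    SmoothL1.shift a (SmoothL1.shift b φ) = SmoothL1.shift (a + b) φ :=
  SmoothL1.ext' fun x => congrArg φ.1 (by abel)

lemma SmoothL1.iteratedFDeriv_shift (a : Eu N) (φ : SmoothL1 N) (k : ℕ) (x : Eu N) :
    iteratedFDeriv ℝ k (SmoothL1.shift a φ) x = iteratedFDeriv ℝ k φ (x - a) := by
  change iteratedFDeriv ℝ k (fun y => φ (y - a)) x = _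
  rw [iteratedFDeriv_comp_sub']

lemma SmoothL1.iteratedFDeriv_sub (φ ψ : SmoothL1 N) (k : ℕ) (x : Eu N) :
    iteratedFDeriv ℝ k (φ - ψ : SmoothL1 N) x =
      iteratedFDeriv ℝ k φ x - iteratedFDeriv ℝ k ψ x :=
  iteratedFDeriv_sub_apply (φ.contDiff_nat k).contDiffAt (ψ.contDiff_nat k).contDiffAt

lemma SmoothL1.continuous_deriv (φ : SmoothL1 N) (k : ℕ) : Continuous (iteratedFDeriv ℝ k φ) :=
  (φ.contDiff_nat k).continuous_iteratedFDeriv le_rfl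

lemma SmoothL1.continuous (φ : SmoothL1 N) : Continuous (φ : Eu N → ℂ) := φ.2.1.continuous

lemma SmoothL1.norms_shift (k : ℕ) (a : Eu N) (φ : SmoothL1 N) :
    SmoothL1.norms N k (SmoothL1.shift a φ) = SmoothL1.norms N k φ := by
  simp only [SmoothL1.norms_apply, SmoothL1.iteratedFDeriv_shift]
  exact integral_sub_right_eq_self (fun x => ‖iteratedFDeriv ℝ k φ x‖) a

lemma SmoothL1.ofReal_norms (k : ℕ) (φ : SmoothL1 N) :
    ENNReal.ofReal (SmoothL1.norms N k φ) = ∫⁻ x, ‖iteratedFDeriv ℝ k φ x‖ₑ := by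
  rw [SmoothL1.norms_apply, ofReal_integral_norm_eq_lintegral_enorm (φ.integrable_deriv k)]

/-- The `L¹`-modulus of continuity is controlled by the derivative. -/
lemma lintegral_enorm_comp_sub_sub_le {F : Type*} [NormedAddCommGroup F] [NormedSpace ℝ F]
    {f : Eu N → F} (hf : ContDiff ℝ 1 f) (a : Eu N) :
    ∫⁻ x, ‖f (x - a) - f x‖ₑ ≤ ‖a‖ₑ * ∫⁻ x, ‖fderiv ℝ f x‖ₑ := by
  have hcont : Continuous (fderiv ℝ f) := hf.continuous_fderiv one_ne_zero
  have hpt : ∀ x, ‖f (x - a) - f x‖ₑ ≤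
      ∫⁻ t in Set.Icc (0 : ℝ) 1, ‖fderiv ℝ f (x - t • a)‖ₑ * ‖a‖ₑ := fun x => by
    have hline : ContDiff ℝ 1 fun t : ℝ => f (x - t • a) :=
      hf.comp (contDiff_const.sub (contDiff_id.smul contDiff_const))
    have h1 := enorm_sub_le_lintegral_deriv_of_contDiffOn_Icc hline.contDiffOn
      (zero_le_one (α := ℝ))
    simp only [one_smul, zero_smul, sub_zero] at h1
    refine h1.trans (lintegral_mono fun t => ?_)
    have hd : HasDerivAt (fun t : ℝ => f (x - t • a)) (fderiv ℝ f (x - t • a) (-a)) t := by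
      have h2 : HasDerivAt (fun t : ℝ => x - t • a) (-a) t := by
        simpa using ((hasDerivAt_id t).smul_const a).const_sub x
      exact ((hf.differentiable one_ne_zero) _).hasFDerivAt.comp_hasDerivAt t h2
    rw [hd.deriv]
    refine (ContinuousLinearMap.le_opENorm _ _).trans ?_
    rw [enorm_neg]
  refine (lintegral_mono hpt).trans ?_
  -- After Tonelli, the inner integral over `x` is independent of `t` by translation invariance.
  rw [lintegral_lintegral_swap]
  · have : ∀ t : ℝ, ∫⁻ x, ‖fderiv ℝ f (x - t • a)‖ₑ * ‖a‖ₑ = ‖a‖ₑ * ∫⁻ x, ‖fderiv ℝ f x‖ₑ := by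
      intro t
      rw [lintegral_mul_const' _ _ enorm_ne_top, mul_comm,
        lintegral_sub_right_eq_self (fun x => ‖fderiv ℝ f x‖ₑ)]
    simp [this]
  · refine Measurable.aemeasurable (Continuous.measurable ?_)
    exact (ENNReal.continuous_mul_const enorm_ne_top).comp
      (hcont.comp (continuous_fst.sub (continuous_snd.smul continuous_const))).enorm

lemma SmoothL1.norms_shift_sub_le (k : ℕ) (a : Eu N) (φ : SmoothL1 N) :
    SmoothL1.norms N k (SmoothL1.shift a φ - φ) ≤ ‖a‖ * SmoothL1.norms N (k + 1) φ := by
  rw [← ENNReal.ofReal_le_ofReal_iff (by positivity), SmoothL1.ofReal_norms,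
    ENNReal.ofReal_mul (norm_nonneg _), SmoothL1.ofReal_norms, ofReal_norm]
  simp only [SmoothL1.iteratedFDeriv_sub, SmoothL1.iteratedFDeriv_shift]
  refine (lintegral_enorm_comp_sub_sub_le
    ((φ.contDiff_nat (k + 1)).iteratedFDeriv_right (m := 1) (by norm_cast; omega)) a).trans_eq ?_
  congr 2
  ext x
  rw [← ofReal_norm, norm_fderiv_iteratedFDeriv, ofReal_norm]

/-- Shifts preserve every seminorm, which moves the question to the origin; there
`norms_shift_sub_le` gives a factor `‖a - b‖` at the cost of one derivative. -/
lemma SmoothL1.continuous_shift (φ : SmoothL1 N) : Continuous fun a => SmoothL1.shift a φ := by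
  rw [continuous_iff_continuousAt]
  intro b
  rw [ContinuousAt, (SmoothL1.withSeminorms N).tendsto_nhds]
  intro k ε hε
  have h : Tendsto (fun a : Eu N => ‖a - b‖ * SmoothL1.norms N (k + 1) φ) (𝓝 b) (𝓝 0) := by
    have : Continuous fun a : Eu N => ‖a - b‖ * SmoothL1.norms N (k + 1) φ := by fun_prop
    simpa using this.tendsto b
  filter_upwards [h.eventually (gt_mem_nhds hε)] with a ha
  refine lt_of_le_of_lt ?_ ha
  have : SmoothL1.shift a φ - SmoothL1.shift b φ =
      SmoothL1.shift b (SmoothL1.shift (a - b) φ - φ) := by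
    rw [map_sub, SmoothL1.shift_shift, add_sub_cancel]
  rw [this, SmoothL1.norms_shift]
  exact SmoothL1.norms_shift_sub_le k _ φ

lemma BoundedDistribution.exists_bound (T : BoundedDistribution N) :
    ∃ (s : Finset ℕ) (C : ℝ≥0), ∀ φ, ‖T φ‖ ≤ C * s.sup (SmoothL1.norms N) φ := by
  obtain ⟨s, C, -, h⟩ := Seminorm.bound_of_continuous (SmoothL1.withSeminorms N)
    ((normSeminorm ℂ ℂ).comp T.toLinearMap) (continuous_norm.comp T.continuous)
  exact ⟨s, C, fun φ => h φ⟩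

/-- Minkowski's inequality in `L¹`. Extended nonnegative integrals make integrability unnecessary;
continuity supplies the measurability for Tonelli. -/
lemma lintegral_enorm_integral_le {F : Type*} [NormedAddCommGroup F] [NormedSpace ℝ F]
    {g : Eu N → Eu N → F} (hg : Continuous (Function.uncurry g)) :
    ∫⁻ x, ‖∫ t, g t x‖ₑ ≤ ∫⁻ t, ∫⁻ x, ‖g t x‖ₑ := by
  refine (lintegral_mono fun x => enorm_integral_le_lintegral_enorm _).trans_eq ?_
  exact lintegral_lintegral_swap (f := fun x t => ‖g t x‖ₑ)
    (hg.comp continuous_swap).enorm.measurable.aemeasurable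

end SmoothL1Facts

/-! ### Differentiation of convolution integrals. -/

section Convolution

variable {N : ℕ}

/-- Local domination of the derivatives of the integrand of `∫ w(t) f(x - t) dt`. -/
def ConvDominated (w f : Eu N → ℂ) : Prop :=
  ∀ (k : ℕ) (x₀ : Eu N), ∃ bound : Eu N → ℝ, Integrable bound ∧
    ∀ᶠ x in 𝓝 x₀, ∀ t, ‖w t‖ * ‖iteratedFDeriv ℝ k f (x - t)‖ ≤ bound t

variable {w f : Eu N → ℂ}

lemma ConvDominated.integrable (H : ConvDominated w f) (hw : Continuous w) (hf : ContDiff ℝ ∞ f)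
    (k : ℕ) (x : Eu N) : Integrable fun t => w t • iteratedFDeriv ℝ k f (x - t) := by
  obtain ⟨b, hb, h⟩ := H k x
  refine hb.mono' ?_ (Eventually.of_forall fun t => ?_)
  · exact (hw.smul ((hf.continuous_iteratedFDeriv (m := k) (mod_cast le_top)).comp
      (continuous_const.sub continuous_id))).aestronglyMeasurable
  · rw [norm_smul]
    exact h.self_of_nhds t

/-- Each order is one differentiation under the integral sign, with all derivatives falling on `f`.
Smoothness and the formula for the derivatives are both read off from the Taylor series. -/
lemma ConvDominated.hasFTaylorSeriesUpTo (H : ConvDominated w f) (hw : Continuous w)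
    (hf : ContDiff ℝ ∞ f) : HasFTaylorSeriesUpTo ∞ (fun x => ∫ t, w t • f (x - t))
      fun x k => ∫ t, w t • iteratedFDeriv ℝ k f (x - t) := by
  have hdiff : ∀ (k : ℕ) (x : Eu N), HasFDerivAt
      (fun x => ∫ t, w t • iteratedFDeriv ℝ k f (x - t))
      (∫ t, w t • iteratedFDeriv ℝ (k + 1) f (x - t)).curryLeft x := by
    intro k x
    obtain ⟨b, hb, h⟩ := H (k + 1) x
    have hc : ∀ k : ℕ, Continuous (iteratedFDeriv ℝ k f) := fun k =>
      hf.continuous_iteratedFDeriv (m := k) (mod_cast le_top)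
    let L : (Eu N [×(k + 1)]→L[ℝ] ℂ) →L[ℝ] Eu N →L[ℝ] Eu N [×k]→L[ℝ] ℂ :=
      (continuousMultilinearCurryLeftEquiv ℝ (fun _ : Fin (k + 1) => Eu N) ℂ
        ).toContinuousLinearEquiv
    have hcurry : (∫ t, w t • iteratedFDeriv ℝ (k + 1) f (x - t)).curryLeft =
        ∫ t, w t • (iteratedFDeriv ℝ (k + 1) f (x - t)).curryLeft := by
      exact (ContinuousLinearMap.integral_comp_comm (𝕜 := ℝ) (E := Eu N [×(k + 1)]→L[ℝ] ℂ)
        (Fₗ := Eu N →L[ℝ] Eu N [×k]→L[ℝ] ℂ) L (H.integrable hw hf (k + 1) x)).symm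
    rw [hcurry]
    refine hasFDerivAt_integral_of_dominated_of_fderiv_le (bound := b)
      (F := fun x t => w t • iteratedFDeriv ℝ k f (x - t))
      (F' := fun x t => w t • (iteratedFDeriv ℝ (k + 1) f (x - t)).curryLeft) h ?_
      (H.integrable hw hf k x) ?_ ?_ hb ?_
    · exact Eventually.of_forall fun y => (hw.smul ((hc k).comp
        (continuous_const.sub continuous_id))).aestronglyMeasurable
    · exact L.continuous.comp_aestronglyMeasurable
        (H.integrable hw hf (k + 1) x).aestronglyMeasurable
    · refine Eventually.of_forall fun t y hy => ?_
      rw [norm_smul]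
      refine le_trans (le_of_eq ?_) (hy t)
      congr 1
      exact (continuousMultilinearCurryLeftEquiv ℝ (fun _ : Fin (k + 1) => Eu N) ℂ).norm_map _
    · refine Eventually.of_forall fun t y _ => ?_
      have h1 : HasFDerivAt (iteratedFDeriv ℝ k f)
          (iteratedFDeriv ℝ (k + 1) f (y - t)).curryLeft (y - t) :=
        hf.ftaylorSeries.fderiv k (mod_cast ENat.natCast_lt_top k) (y - t)
      have h2 := h1.comp y ((hasFDerivAt_id y).sub_const t)
      exact h2.const_smul (w t)
  refine ⟨fun x => ?_, fun k _ x => hdiff k x, fun k _ => ?_⟩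
  · have := (continuousMultilinearCurryFin0 ℝ (Eu N) ℂ
      ).toContinuousLinearEquiv.toContinuousLinearMap.integral_comp_comm (H.integrable hw hf 0 x)
    exact this.symm
  · exact continuous_iff_continuousAt.2 fun x => (hdiff k x).continuousAt

lemma ConvDominated.contDiff (H : ConvDominated w f) (hw : Continuous w)
    (hf : ContDiff ℝ ∞ f) : ContDiff ℝ ∞ fun x => ∫ t, w t • f (x - t) :=
  (H.hasFTaylorSeriesUpTo hw hf).contDiff

lemma ConvDominated.iteratedFDeriv_eq (H : ConvDominated w f) (hw : Continuous w)
    (hf : ContDiff ℝ ∞ f) (k : ℕ) (x : Eu N) :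
    iteratedFDeriv ℝ k (fun x => ∫ t, w t • f (x - t)) x =
      ∫ t, w t • iteratedFDeriv ℝ k f (x - t) :=
  ((H.hasFTaylorSeriesUpTo hw hf).eq_iteratedFDeriv (mod_cast le_top) x).symm

lemma HasCompactSupport.convDominated_right (hw : Continuous w) (hf : ContDiff ℝ ∞ f)
    (hfc : HasCompactSupport f) : ConvDominated w f := by
  intro k x₀
  have hc : Continuous (iteratedFDeriv ℝ k f) :=
    hf.continuous_iteratedFDeriv (m := k) (mod_cast le_top)
  obtain ⟨C, hC⟩ := hc.bounded_above_of_compact_support (hfc.iteratedFDeriv k)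
  obtain ⟨R, hR⟩ := (hfc.iteratedFDeriv (𝕜 := ℝ) k).isCompact.isBounded.subset_closedBall 0
  -- For `x` within `1` of `x₀`, a point `x - t` of the support has norm at most `R`, so `t` is
  -- within `R + 1` of `x₀`.
  refine ⟨(Metric.closedBall x₀ (R + 1)).indicator fun t => ‖w t‖ * C, ?_, ?_⟩
  · rw [integrable_indicator_iff Metric.isClosed_closedBall.measurableSet]
    exact (hw.norm.mul continuous_const).continuousOn.integrableOn_compact
      (isCompact_closedBall _ _)
  · filter_upwards [Metric.closedBall_mem_nhds x₀ one_pos] with x hx t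
    by_cases ht : t ∈ Metric.closedBall x₀ (R + 1)
    · rw [Set.indicator_of_mem ht]
      exact mul_le_mul_of_nonneg_left (hC _) (norm_nonneg _)
    · rw [Set.indicator_of_notMem ht]
      have : iteratedFDeriv ℝ k f (x - t) = 0 := by
        refine image_eq_zero_of_notMem_tsupport fun hmem => ht ?_
        have h1 := hR hmem
        rw [mem_closedBall_zero_iff] at h1
        rw [Metric.mem_closedBall, dist_comm] at hx ⊢
        rw [dist_eq_norm] at *
        have : x₀ - t = (x₀ - x) + (x - t) := by abel
        rw [this]
        linarith [norm_add_le (x₀ - x) (x - t)]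
      rw [this, norm_zero, mul_zero]

lemma HasCompactSupport.convDominated_left (hw : Continuous w) (hf : ContDiff ℝ ∞ f)
    (hwc : HasCompactSupport w) : ConvDominated w f := by
  intro k x₀
  have hc : Continuous (iteratedFDeriv ℝ k f) :=
    hf.continuous_iteratedFDeriv (m := k) (mod_cast le_top)
  obtain ⟨R, hR⟩ := hwc.isCompact.isBounded.subset_closedBall 0
  obtain ⟨C, hC⟩ := (isCompact_closedBall x₀ (R + 1)).exists_bound_of_continuousOn hc.continuousOn
  refine ⟨fun t => ‖w t‖ * C, (hw.integrable_of_hasCompactSupport hwc).norm.mul_const C, ?_⟩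
  filter_upwards [Metric.closedBall_mem_nhds x₀ one_pos] with x hx t
  by_cases ht : t ∈ tsupport w
  · refine mul_le_mul_of_nonneg_left (hC _ ?_) (norm_nonneg _)
    have h1 := hR ht
    rw [mem_closedBall_zero_iff] at h1
    rw [Metric.mem_closedBall, dist_eq_norm] at *
    have : x - t - x₀ = (x - x₀) - t := by abel
    rw [this]
    linarith [norm_sub_le (x - x₀) t]
  · rw [image_eq_zero_of_notMem_tsupport ht, norm_zero, zero_mul, zero_mul]

end Convolution

/-! ### Convolution on `𝒟_{L¹}` and its interchange with distributions. -/

section ConvolutionOperator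

variable {N : ℕ}

lemma continuous_conv_integrand {F : Type*} [NormedAddCommGroup F] [NormedSpace ℂ F]
    {w : Eu N → ℂ} {f : Eu N → F} (hw : Continuous w) (hf : Continuous f) :
    Continuous (Function.uncurry fun t x : Eu N => w t • f (x - t)) :=
  (hw.comp continuous_fst).smul (hf.comp (continuous_snd.sub continuous_fst))

namespace SmoothL1

lemma lintegral_conv_le (θ φ : SmoothL1 N) (k : ℕ) :
    ∫⁻ x, ‖∫ t, θ t • iteratedFDeriv ℝ k φ (x - t)‖ₑ ≤
      (∫⁻ t, ‖θ t‖ₑ) * ENNReal.ofReal (norms N k φ) := by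
  refine (lintegral_enorm_integral_le
    (continuous_conv_integrand θ.continuous (φ.continuous_deriv k))).trans_eq ?_
  simp only [enorm_smul]
  rw [← lintegral_mul_const' _ _ ENNReal.ofReal_ne_top]
  refine lintegral_congr fun t => ?_
  rw [lintegral_const_mul' _ _ enorm_ne_top,
    lintegral_sub_right_eq_self (fun x => ‖iteratedFDeriv ℝ k φ x‖ₑ), ofReal_norms]

/-- Convolution with a compactly supported test function. -/
def conv (θ : SmoothL1 N) (hθ : HasCompactSupport θ) (φ : SmoothL1 N) : SmoothL1 N :=
  ⟨fun x => ∫ t, θ t • φ (x - t),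
    (HasCompactSupport.convDominated_left θ.continuous φ.2.1 hθ).contDiff θ.continuous φ.2.1,
    fun k => by
      have H := HasCompactSupport.convDominated_left θ.continuous φ.2.1 hθ
      refine ⟨Continuous.aestronglyMeasurable ?_, ?_⟩
      · exact (H.contDiff θ.continuous φ.2.1).continuous_iteratedFDeriv (mod_cast le_top)
      · rw [HasFiniteIntegral]
        simp only [H.iteratedFDeriv_eq θ.continuous φ.2.1]
        refine (lintegral_conv_le θ φ k).trans_lt (ENNReal.mul_lt_top ?_ ENNReal.ofReal_lt_top)
        exact θ.integrable.2⟩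

variable {θ : SmoothL1 N} (hθ : HasCompactSupport θ) (φ : SmoothL1 N)

lemma conv_apply (x : Eu N) : conv θ hθ φ x = ∫ t, θ t • φ (x - t) := rfl

lemma conv_apply' (x : Eu N) : conv θ hθ φ x = ∫ t, φ t • θ (x - t) := by
  rw [conv_apply, ← integral_sub_left_eq_self _ volume x]
  simp only [sub_sub_cancel, smul_eq_mul, mul_comm]

lemma iteratedFDeriv_conv (k : ℕ) (x : Eu N) : iteratedFDeriv ℝ k (conv θ hθ φ) x =
    ∫ t, θ t • iteratedFDeriv ℝ k φ (x - t) :=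
  (HasCompactSupport.convDominated_left θ.continuous φ.2.1 hθ).iteratedFDeriv_eq
    θ.continuous φ.2.1 k x

/-- With the derivatives on `θ`, the convolution is a superposition of the translates of `θ` with
weight `φ`, the form needed to move a distribution inside. `iteratedFDeriv_conv` is the form for
seminorm estimates in `φ`. -/
lemma iteratedFDeriv_conv' (k : ℕ) (x : Eu N) : iteratedFDeriv ℝ k (conv θ hθ φ) x =
    ∫ t, φ t • iteratedFDeriv ℝ k θ (x - t) := by
  have : (conv θ hθ φ : Eu N → ℂ) = fun x => ∫ t, φ t • θ (x - t) := funext (conv_apply' hθ φ)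
  rw [this]
  exact (HasCompactSupport.convDominated_right φ.continuous θ.2.1 hθ).iteratedFDeriv_eq
    φ.continuous θ.2.1 k x

lemma norms_conv_le (h1 : ∫⁻ t, ‖θ t‖ₑ ≤ 1) (k : ℕ) : norms N k (conv θ hθ φ) ≤ norms N k φ := by
  rw [← ENNReal.ofReal_le_ofReal_iff (apply_nonneg _ _), ofReal_norms]
  simp only [iteratedFDeriv_conv]
  refine (lintegral_conv_le θ φ k).trans ?_
  exact mul_le_of_le_one_left (zero_le) h1

/-- As `∫ θ = 1`, the difference is an average of `φ(· - t) - φ` over `‖t‖ ≤ ε`, and each of these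
costs `ε` and one derivative. -/
lemma norms_conv_sub_le (h1 : ∫⁻ t, ‖θ t‖ₑ ≤ 1) (h2 : ∫ t, θ t = 1) {ε : ℝ}
    (hε : ∀ t, θ t ≠ 0 → ‖t‖ ≤ ε) (h0 : 0 ≤ ε) (k : ℕ) :
    norms N k (conv θ hθ φ - φ) ≤ ε * norms N (k + 1) φ := by
  rw [← ENNReal.ofReal_le_ofReal_iff (by positivity), ofReal_norms]
  have hpt : ∀ x, iteratedFDeriv ℝ k (conv θ hθ φ - φ : SmoothL1 N) x =
      ∫ t, θ t • (iteratedFDeriv ℝ k φ (x - t) - iteratedFDeriv ℝ k φ x) := fun x => by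
    rw [iteratedFDeriv_sub, iteratedFDeriv_conv]
    simp only [smul_sub]
    rw [integral_sub
      ((HasCompactSupport.convDominated_left θ.continuous φ.2.1 hθ).integrable
        θ.continuous φ.2.1 k x) (θ.integrable.smul_const _), integral_smul_const, h2, one_smul]
  simp only [hpt]
  refine (lintegral_enorm_integral_le ?_).trans ?_
  · exact (θ.continuous.comp continuous_fst).smul
      (((φ.continuous_deriv k).comp (continuous_snd.sub continuous_fst)).sub
        ((φ.continuous_deriv k).comp continuous_snd))
  · calc ∫⁻ t, ∫⁻ x, ‖θ t • (iteratedFDeriv ℝ k φ (x - t) - iteratedFDeriv ℝ k φ x)‖ₑ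
        ≤ ∫⁻ t, ‖θ t‖ₑ * ENNReal.ofReal (ε * norms N (k + 1) φ) := by
          refine lintegral_mono fun t => ?_
          simp only [enorm_smul]
          rw [lintegral_const_mul' _ _ enorm_ne_top]
          by_cases ht : θ t = 0
          · simp [ht]
          · gcongr
            have h3 := (norms_shift_sub_le k t φ).trans
              (mul_le_mul_of_nonneg_right (hε t ht) (apply_nonneg (norms N (k + 1)) φ))
            refine le_trans (le_of_eq ?_) (ENNReal.ofReal_le_ofReal h3)
            rw [ofReal_norms]
            simp only [iteratedFDeriv_sub, iteratedFDeriv_shift]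
      _ = (∫⁻ t, ‖θ t‖ₑ) * ENNReal.ofReal (ε * norms N (k + 1) φ) :=
          lintegral_mul_const' _ _ ENNReal.ofReal_ne_top
      _ ≤ ENNReal.ofReal (ε * norms N (k + 1) φ) := mul_le_of_le_one_left (zero_le) h1

/-- The `L¹`-class of the `k`-th derivative. -/
def jet (N k : ℕ) : SmoothL1 N →ₗ[ℂ] Lp (Eu N [×k]→L[ℝ] ℂ) 1 (volume : Measure (Eu N)) where
  toFun φ := (φ.integrable_deriv k).toL1
  map_add' φ ψ := by
    rw [← Integrable.toL1_add, Integrable.toL1_eq_toL1_iff]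
    refine Eventually.of_forall fun x => ?_
    exact iteratedFDeriv_add_apply (φ.contDiff_nat k).contDiffAt (ψ.contDiff_nat k).contDiffAt
  map_smul' c φ := by
    rw [RingHom.id_apply, ← Integrable.toL1_smul', Integrable.toL1_eq_toL1_iff]
    refine Eventually.of_forall fun x => ?_
    exact iteratedFDeriv_const_smul_apply (φ.contDiff_nat k).contDiffAt

lemma jet_coeFn (k : ℕ) (φ : SmoothL1 N) : jet N k φ =ᵐ[volume] iteratedFDeriv ℝ k φ :=
  (φ.integrable_deriv k).coeFn_toL1

lemma norm_jet (k : ℕ) (φ : SmoothL1 N) : ‖jet N k φ‖ = norms N k φ := by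
  rw [L1.norm_eq_integral_norm, norms_apply]
  exact integral_congr_ae ((jet_coeFn k φ).mono fun x hx => by simp only [hx])

lemma continuous_jet (N k : ℕ) : Continuous (jet N k) := by
  refine continuous_of_continuousAt_zero (jet N k) ?_
  rw [ContinuousAt, map_zero, tendsto_zero_iff_norm_tendsto_zero]
  simp only [norm_jet]
  simpa using ((withSeminorms N).continuous_seminorm k).tendsto 0

lemma integrable_smul_jet_shift (χ θ : SmoothL1 N) (k : ℕ) :
    Integrable fun t => χ t • jet N k (shift t θ) := by
  refine (χ.integrable.norm.mul_const (norms N k θ)).mono' ?_ (Eventually.of_forall fun t => ?_)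
  · have : Continuous fun t => jet N k (shift t θ) :=
      (continuous_jet N k).comp θ.continuous_shift
    exact χ.continuous.aestronglyMeasurable.smul this.aestronglyMeasurable
  · rw [norm_smul, norm_jet, norms_shift]

/-- The `L¹`-valued integral of the translates is the convolution. -/
lemma integral_smul_jet_shift (k : ℕ) :
    ∫ t, φ t • jet N k (shift t θ) = jet N k (conv θ hθ φ) := by
  refine Lp.ext (Integrable.ae_eq_of_forall_setIntegral_eq _ _ (L1.integrable_coeFn _)
    (L1.integrable_coeFn _) fun s hs _ => ?_)
  -- Classes in `L¹` are determined by their integrals over measurable sets of finite measure.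
  -- Integration over `s` is continuous and linear, so it enters the `L¹`-valued integral, and
  -- Fubini remains.
  let S : Lp (Eu N [×k]→L[ℝ] ℂ) 1 (volume : Measure (Eu N)) →L[ℂ] (Eu N [×k]→L[ℝ] ℂ) :=
    LinearMap.mkContinuous
      { toFun := fun h => ∫ x in s, h x
        map_add' := fun g h => by
          rw [← integral_add (L1.integrable_coeFn g).integrableOn
            (L1.integrable_coeFn h).integrableOn]
          exact integral_congr_ae (ae_restrict_of_ae (Lp.coeFn_add g h))
        map_smul' := fun c h => by
          rw [RingHom.id_apply, ← integral_smul]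
          exact integral_congr_ae (ae_restrict_of_ae (Lp.coeFn_smul c h)) } 1
      fun h => by
        rw [one_mul, L1.norm_eq_integral_norm]
        refine (norm_integral_le_integral_norm _).trans ?_
        exact setIntegral_le_integral (L1.integrable_coeFn h).norm
          (Eventually.of_forall fun _ => norm_nonneg _)
  have hS : ∀ ψ : SmoothL1 N, S (jet N k ψ) = ∫ x in s, iteratedFDeriv ℝ k ψ x := fun ψ =>
    integral_congr_ae (ae_restrict_of_ae (jet_coeFn k ψ))
  change S (∫ t, φ t • jet N k (shift t θ)) = S (jet N k (conv θ hθ φ))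
  rw [← S.integral_comp_comm (integrable_smul_jet_shift φ θ k), hS]
  simp only [map_smul, hS, iteratedFDeriv_conv', iteratedFDeriv_shift, ← integral_smul]
  refine integral_integral_swap (f := fun t x => φ t • iteratedFDeriv ℝ k θ (x - t)) ?_
  have h := Integrable.convolution_integrand (ContinuousLinearMap.lsmul ℝ ℂ) φ.integrable
    (θ.integrable_deriv k)
  have h2 := h.swap
  refine h2.mono_measure ?_
  exact Measure.prod_mono le_rfl Measure.restrict_le_self

end SmoothL1

/-- A bounded distribution can be interchanged with a convolution integral. -/
lemma BoundedDistribution.apply_conv (T : BoundedDistribution N) {θ : SmoothL1 N}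
    (hθ : HasCompactSupport θ) (φ : SmoothL1 N) :
    T (SmoothL1.conv θ hθ φ) = ∫ t, φ t • T (SmoothL1.shift t θ) := by
  obtain ⟨s, C, hC⟩ := T.exists_bound
  -- `T` is controlled by finitely many seminorms, so it factors through a finite tuple of jets, in
  -- a Banach space where Bochner integrals commute with functionals.
  let J : SmoothL1 N →ₗ[ℂ] ∀ i : s, Lp (Eu N [×i.1]→L[ℝ] ℂ) 1 (volume : Measure (Eu N)) :=
    LinearMap.pi fun i => SmoothL1.jet N i
  have hT : ∀ ψ, ‖T ψ‖ ≤ C * ‖J ψ‖ := fun ψ => by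
    refine (hC ψ).trans ?_
    gcongr
    refine Seminorm.finset_sup_apply_le (norm_nonneg _) fun i hi => ?_
    rw [← SmoothL1.norm_jet]
    exact norm_le_pi_norm (ι := s) (J ψ) ⟨i, hi⟩
  have hker : LinearMap.ker J ≤ LinearMap.ker T.toLinearMap := fun ψ hψ => by
    rw [LinearMap.mem_ker] at hψ ⊢
    have := hT ψ
    rw [hψ, norm_zero, mul_zero] at this
    exact norm_le_zero_iff.1 this
  let F₀ : LinearMap.range J →ₗ[ℂ] ℂ :=
    (LinearMap.ker J).liftQ T.toLinearMap hker ∘ₗ J.quotKerEquivRange.symm.toLinearMap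
  have hF₀ : ∀ ψ, F₀ ⟨J ψ, ψ, rfl⟩ = T ψ := fun ψ => by
    have : J.quotKerEquivRange.symm ⟨J ψ, ψ, rfl⟩ = (LinearMap.ker J).mkQ ψ :=
      J.quotKerEquivRange_symm_apply_image ψ _
    change (LinearMap.ker J).liftQ T.toLinearMap hker (J.quotKerEquivRange.symm _) = _
    rw [this]
    rfl
  let F₁ : LinearMap.range J →L[ℂ] ℂ := F₀.mkContinuous C (by
    rintro ⟨_, ψ, rfl⟩
    rw [hF₀]
    exact hT ψ)
  -- The Bochner integral is formed in the full product of `L¹` spaces, so the functional must be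
  -- defined beyond the range of `J`.
  obtain ⟨F, hF, -⟩ := exists_extension_norm_eq (LinearMap.range J) F₁
  have hFJ : ∀ ψ, F (J ψ) = T ψ := fun ψ => (hF ⟨J ψ, ψ, rfl⟩).trans (hF₀ ψ)
  have hint : Integrable fun t => φ t • J (SmoothL1.shift t θ) :=
    Integrable.of_eval fun i => SmoothL1.integrable_smul_jet_shift φ θ i
  have hJ : J (SmoothL1.conv θ hθ φ) = ∫ t, φ t • J (SmoothL1.shift t θ) := by
    ext1 i
    refine (SmoothL1.integral_smul_jet_shift hθ φ i).symm.trans ?_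
    exact (eval_integral (f := fun t => φ t • J (SmoothL1.shift t θ))
      (fun j => SmoothL1.integrable_smul_jet_shift φ θ j) i).symm
  rw [← hFJ, hJ, ← F.integral_comp_comm hint]
  simp only [map_smul, hFJ]

end ConvolutionOperator

/-! ### Neighbourhoods of zero in the strong dual. -/

section StrongDual

variable {E : Type*} [AddCommGroup E] [Module ℂ E] [TopologicalSpace E]

lemma hasBasis_nhds_zero_strongDual : (𝓝 (0 : E →L[ℂ] ℂ)).HasBasis
    (fun p : Set E × ℝ => Bornology.IsVonNBounded ℂ p.1 ∧ 0 < p.2)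
    fun p => {S | ∀ φ ∈ p.1, ‖S φ‖ < p.2} := by
  have := ContinuousLinearMap.hasBasis_nhds_zero_of_basis (σ := RingHom.id ℂ) (E := E) (F := ℂ)
    Metric.nhds_basis_ball
  simpa using this

lemma tendsto_zero_strongDual {α : Type*} {l : Filter α} {S : α → E →L[ℂ] ℂ} :
    Tendsto S l (𝓝 0) ↔ ∀ B : Set E, Bornology.IsVonNBounded ℂ B → ∀ ε > 0,
      ∀ᶠ a in l, ∀ φ ∈ B, ‖S a φ‖ < ε := by
  rw [hasBasis_nhds_zero_strongDual.tendsto_right_iff]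
  exact ⟨fun h B hB ε hε => h (B, ε) ⟨hB, hε⟩, fun h p hp => h p.1 hp.1 p.2 hp.2⟩

end StrongDual

/-! ### Passage between almost periodic functions and distributions; closedness of `ℬ'_AP`. -/

section Distributions

variable {N : ℕ}

lemma SmoothL1.isVonNBounded_iff {B : Set (SmoothL1 N)} : Bornology.IsVonNBounded ℂ B ↔
    ∀ k, ∃ r > 0, ∀ φ ∈ B, SmoothL1.norms N k φ < r :=
  (SmoothL1.withSeminorms N).isVonNBounded_iff_seminorm_bounded

/-- First countability makes the space bornological, so that its strong dual is complete and closed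
totally bounded sets there are compact. -/
instance : FirstCountableTopology (SmoothL1 N) := (SmoothL1.withSeminorms N).firstCountableTopology

/-- Needed so that linear forms bounded on bounded sets are continuous. -/
instance : FirstCountableTopology (DAP N) := (DAP.withSeminorms N).firstCountableTopology

/-- The set of all translates of the elements of a bounded set is bounded. -/
lemma SmoothL1.isVonNBounded_shift {B : Set (SmoothL1 N)} (hB : Bornology.IsVonNBounded ℂ B) :
    Bornology.IsVonNBounded ℂ {ψ | ∃ a, ∃ φ ∈ B, ψ = SmoothL1.shift a φ} := by
  rw [SmoothL1.isVonNBounded_iff] at *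
  intro k
  obtain ⟨r, hr, h⟩ := hB k
  refine ⟨r, hr, ?_⟩
  rintro _ ⟨a, φ, hφ, rfl⟩
  rw [SmoothL1.norms_shift]
  exact h φ hφ

lemma integrable_bcf_mul (f : Eu N →ᵇ ℂ) (φ : SmoothL1 N) : Integrable fun x => f x * φ x :=
  φ.integrable.bdd_mul f.continuous.aestronglyMeasurable
    (Eventually.of_forall f.norm_coe_le_norm)

lemma norm_integral_bcf_mul_le (f : Eu N →ᵇ ℂ) (φ : SmoothL1 N) :
    ‖∫ x, f x * φ x‖ ≤ ‖f‖ * SmoothL1.norms N 0 φ := by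
  rw [SmoothL1.norms_apply, ← integral_const_mul]
  refine norm_integral_le_of_norm_le ((φ.integrable_deriv 0).norm.const_mul _)
    (Eventually.of_forall fun x => ?_)
  rw [norm_mul, norm_iteratedFDeriv_zero]
  gcongr
  exact f.norm_coe_le_norm x

/-- The linear form `φ ↦ ∫ f φ` on `𝒟_{L¹}` given by a bounded continuous function. -/
def bcfForm (f : Eu N →ᵇ ℂ) : SmoothL1 N →ₗ[ℂ] ℂ where
  toFun φ := ∫ x, f x * φ x
  map_add' φ ψ := by
    rw [← integral_add (integrable_bcf_mul f φ) (integrable_bcf_mul f ψ)]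
    exact integral_congr_ae (Eventually.of_forall fun x => mul_add (f x) (φ x) (ψ x))
  map_smul' c φ := by
    rw [RingHom.id_apply, ← integral_smul]
    exact integral_congr_ae (Eventually.of_forall fun x => mul_left_comm (f x) c (φ x))

/-- The distribution `φ ↦ ∫ f φ` given by a bounded continuous function, as a linear map. -/
def distOfBCFLinear (N : ℕ) : (Eu N →ᵇ ℂ) →ₗ[ℂ] BoundedDistribution N where
  toFun f :=
    { toLinearMap := bcfForm f
      cont := by
        refine WithSeminorms.continuous_of_isBounded (τ₁₂ := RingHom.id ℂ)
          (SmoothL1.withSeminorms N) (norm_withSeminorms ℂ ℂ) (bcfForm f)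
          fun _ => ⟨{0}, ‖f‖₊, fun φ => ?_⟩
        rw [Finset.sup_singleton]
        exact norm_integral_bcf_mul_le f φ }
  map_add' f g := ContinuousLinearMap.ext fun φ => by
    change ∫ x, (f x + g x) * φ x = (∫ x, f x * φ x) + ∫ x, g x * φ x
    rw [← integral_add (integrable_bcf_mul f φ) (integrable_bcf_mul g φ)]
    exact integral_congr_ae (Eventually.of_forall fun x => add_mul (f x) (g x) (φ x))
  map_smul' c f := ContinuousLinearMap.ext fun φ => by
    change ∫ x, (c * f x) * φ x = c * ∫ x, f x * φ x
    rw [← integral_const_mul]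
    exact integral_congr_ae (Eventually.of_forall fun x => mul_assoc c (f x) (φ x))

/-- The distribution `φ ↦ ∫ f φ` given by a bounded continuous function. -/
def distOfBCF (N : ℕ) : (Eu N →ᵇ ℂ) →L[ℂ] BoundedDistribution N where
  toLinearMap := distOfBCFLinear N
  cont := by
    change Continuous (distOfBCFLinear N)
    refine continuous_of_continuousAt_zero (distOfBCFLinear N) ?_
    rw [ContinuousAt, map_zero, tendsto_zero_strongDual]
    intro B hB ε hε
    obtain ⟨r, hr, h⟩ := SmoothL1.isVonNBounded_iff.1 hB 0
    filter_upwards [Metric.ball_mem_nhds (0 : Eu N →ᵇ ℂ) (div_pos hε hr)] with f hf φ hφ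
    rw [mem_ball_zero_iff, lt_div_iff₀ hr] at hf
    refine (norm_integral_bcf_mul_le f φ).trans_lt (lt_of_le_of_lt ?_ hf)
    gcongr
    exact (h φ hφ).le

lemma distOfBCF_apply (f : Eu N →ᵇ ℂ) (φ : SmoothL1 N) : distOfBCF N f φ = ∫ x, f x * φ x := rfl

lemma distTranslate_apply (a : Eu N) (T : BoundedDistribution N) (φ : SmoothL1 N) :
    distTranslate a T φ = T (SmoothL1.shift a φ) := rfl

lemma distOfBCF_bcfTranslate (a : Eu N) (f : Eu N →ᵇ ℂ) :
    distOfBCF N (bcfTranslate a f) = distTranslate a (distOfBCF N f) := by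
  ext φ
  rw [distTranslate_apply, distOfBCF_apply, distOfBCF_apply,
    ← integral_sub_right_eq_self _ a]
  simp only [bcfTranslate_apply, sub_add_cancel]
  rfl

/-- A continuous map commuting with translations carries relatively compact orbits to relatively
compact orbits; `isBohrAP_evalBCF` returns to functions by the same principle. -/
lemma distOfBCF_mem {f : Eu N →ᵇ ℂ} (hf : IsBohrAP f) : distOfBCF N f ∈ apDistributions N := by
  rw [isBohrAP_coe_iff] at hf
  refine (hf.image (distOfBCF N).continuous).closure_of_subset ?_
  rintro _ ⟨a, rfl⟩
  exact ⟨_, subset_closure ⟨a, rfl⟩, distOfBCF_bcfTranslate a f⟩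

lemma exists_bound_apply_shift (T : BoundedDistribution N) (θ : SmoothL1 N) :
    ∃ C, ∀ a, ‖T (SmoothL1.shift a θ)‖ ≤ C := by
  obtain ⟨s, C, h⟩ := T.exists_bound
  refine ⟨C * s.sup (SmoothL1.norms N) θ, fun a => (h _).trans ?_⟩
  gcongr
  refine Seminorm.finset_sup_apply_le (apply_nonneg _ _) fun k hk => ?_
  rw [SmoothL1.norms_shift]
  exact Seminorm.le_finset_sup_apply hk

/-- The function `a ↦ ⟨T, θ(· - a)⟩`, as a linear function of `T`. -/
def evalBCFLinear (θ : SmoothL1 N) : BoundedDistribution N →ₗ[ℂ] (Eu N →ᵇ ℂ) where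
  toFun T := BoundedContinuousFunction.ofNormedAddCommGroup (fun a => T (SmoothL1.shift a θ))
    (T.continuous.comp θ.continuous_shift) _ (exists_bound_apply_shift T θ).choose_spec
  map_add' _ _ := rfl
  map_smul' _ _ := rfl

/-- The function `a ↦ ⟨T, θ(· - a)⟩`, as a continuous linear function of `T`. -/
def evalBCF (θ : SmoothL1 N) : BoundedDistribution N →L[ℂ] (Eu N →ᵇ ℂ) where
  toLinearMap := evalBCFLinear θ
  cont := by
    change Continuous (evalBCFLinear θ)
    refine continuous_of_continuousAt_zero (evalBCFLinear θ) ?_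
    rw [ContinuousAt, map_zero, Metric.tendsto_nhds]
    intro ε hε
    -- The sup norm of `evalBCF θ T` is the supremum of `|T|` over all translates of `θ`, a bounded
    -- set and hence one that the strong topology controls.
    have hB := SmoothL1.isVonNBounded_shift (Bornology.isVonNBounded_singleton (𝕜 := ℂ) θ)
    filter_upwards [tendsto_zero_strongDual.1 (tendsto_id (α := BoundedDistribution N)) _ hB
      (ε / 2) (half_pos hε)] with T hT
    rw [dist_zero_right]
    refine lt_of_le_of_lt ?_ (half_lt_self hε)
    exact (BoundedContinuousFunction.norm_le (half_pos hε).le).2 fun a =>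
      (hT _ ⟨a, θ, rfl, rfl⟩).le

lemma evalBCF_apply (θ : SmoothL1 N) (T : BoundedDistribution N) (a : Eu N) :
    evalBCF θ T a = T (SmoothL1.shift a θ) := rfl

lemma evalBCF_distTranslate (θ : SmoothL1 N) (T : BoundedDistribution N) (a : Eu N) :
    evalBCF θ (distTranslate a T) = bcfTranslate a (evalBCF θ T) := by
  ext b
  rw [bcfTranslate_apply, evalBCF_apply, evalBCF_apply, distTranslate_apply,
    SmoothL1.shift_shift, add_comm]

lemma isBohrAP_evalBCF (θ : SmoothL1 N) {T : BoundedDistribution N}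
    (hT : T ∈ apDistributions N) : IsBohrAP (evalBCF θ T) := by
  rw [isBohrAP_coe_iff]
  refine (IsCompact.image hT (evalBCF θ).continuous).closure_of_subset ?_
  rintro _ ⟨a, rfl⟩
  exact ⟨_, subset_closure ⟨a, rfl⟩, evalBCF_distTranslate θ T a⟩

lemma MeanRel.map {f : Eu N →ᵇ ℂ} {c d : ℂ} (hf : MeanRel f c)
    (A : (Eu N →ᵇ ℂ) →L[ℂ] (Eu N →ᵇ ℂ)) (hA : ∀ a, A (bcfTranslate a f) = bcfTranslate a (A f))
    (hc : A (BoundedContinuousFunction.const (Eu N) c) =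
      BoundedContinuousFunction.const (Eu N) d) : MeanRel (A f) d := by
  rw [MeanRel, ← hc]
  refine hf.mem_of_convex
    (s := A ⁻¹' closure (convexHull ℝ (Set.range fun a => bcfTranslate a (A f)))) ?_ ?_ fun a => ?_
  · exact (convex_convexHull ℝ _).closure.linear_preimage (A.toLinearMap.restrictScalars ℝ)
  · exact isClosed_closure.preimage A.continuous
  · exact subset_closure (subset_convexHull ℝ _ ⟨a, (hA a).symm⟩)

/-- The map `f ↦ evalBCF θ (distOfBCF N f)` commutes with translations and multiplies constants by
`∫ θ`; so it multiplies means by the same factor. -/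
lemma meanForm_evalBCF_distOfBCF {f : Eu N →ᵇ ℂ} (hf : IsBohrAP f) (θ : SmoothL1 N) :
    meanForm N (evalBCF θ (distOfBCF N f)) = meanForm N f * ∫ x, θ x := by
  refine (meanRel_meanForm (isBohrAP_evalBCF θ (distOfBCF_mem hf))).unique
    ((meanRel_meanForm hf).map (evalBCF θ ∘L distOfBCF N) (fun a => ?_) ?_)
  · change evalBCF θ (distOfBCF N _) = _
    rw [distOfBCF_bcfTranslate, evalBCF_distTranslate]
    rfl
  · ext a
    change ∫ x, meanForm N f * θ (x - a) = meanForm N f * ∫ x, θ x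
    rw [integral_const_mul, integral_sub_right_eq_self (fun x => θ x)]

/-- A function in `AP^∞` as a bounded continuous function. -/
def APInfty.toBCF (u : APInfty N) : Eu N →ᵇ ℂ := u.isBohrAP.choose

@[simp] lemma APInfty.coe_toBCF (u : APInfty N) : ⇑u.toBCF = u := u.isBohrAP.choose_spec.1

lemma APInfty.toBCF_apply (u : APInfty N) (x : Eu N) : u.toBCF x = u x :=
  congrFun u.coe_toBCF x

lemma APInfty.isBohrAP_toBCF (u : APInfty N) : IsBohrAP u.toBCF := by
  rw [u.coe_toBCF]
  exact u.isBohrAP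

lemma distOfBCF_toBCF (u : APInfty N) : distOfBCF N u.toBCF = distOfFun u := by
  ext φ
  rw [distOfBCF_apply, u.coe_toBCF]
  rfl

lemma distOfFun_mem (u : APInfty N) : distOfFun u ∈ apDistributions N := by
  rw [← distOfBCF_toBCF]
  exact distOfBCF_mem u.isBohrAP_toBCF

lemma distMul_apply (u : APInfty N) (T : BoundedDistribution N) (φ : SmoothL1 N) :
    distMul u T φ = T (mulTest u φ) := rfl

lemma distMul_distOfBCF (u : APInfty N) (f : Eu N →ᵇ ℂ) :
    distMul u (distOfBCF N f) = distOfBCF N (u.toBCF * f) := by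
  ext φ
  rw [distMul_apply, distOfBCF_apply, distOfBCF_apply]
  refine integral_congr_ae (Eventually.of_forall fun x => ?_)
  change f x * (u x * φ x) = u.toBCF x * f x * φ x
  rw [u.toBCF_apply]
  ring

lemma continuous_distMul (u : APInfty N) : Continuous (distMul u) :=
  (ContinuousLinearMap.precomp ℂ (mulTest u)).continuous

/-- By completeness, total boundedness of the orbit is enough. If `T'` is close to `T` on all
translates of a bounded set `B`, their orbits are uniformly close on `B`, and a finite net for the
orbit of `T'` serves that of `T`. -/
lemma isClosed_apDistributions (N : ℕ) :
    IsClosed (apDistributions N : Set (BoundedDistribution N)) := by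
  rw [← closure_subset_iff_isClosed]
  intro T hT
  have hsub : ∀ {B : Set (SmoothL1 N)} {ε : ℝ}, Bornology.IsVonNBounded ℂ B → 0 < ε →
      {S : BoundedDistribution N | ∀ φ ∈ B, ‖S φ‖ < ε} ∈ 𝓝 0 := fun {B ε} hB hε =>
    hasBasis_nhds_zero_strongDual.mem_of_mem (i := (B, ε)) ⟨hB, hε⟩
  have htb : TotallyBounded (Set.range fun a => distTranslate a T) := by
    rw [totallyBounded_iff_subset_finite_iUnion_nhds_zero]
    intro U hU
    obtain ⟨⟨B, ε⟩, ⟨hB, hε⟩, hBU⟩ := hasBasis_nhds_zero_strongDual.mem_iff.1 hU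
    obtain ⟨T', hT', hTT'⟩ : ∃ T' ∈ apDistributions N, ∀ a, ∀ φ ∈ B,
        ‖T (SmoothL1.shift a φ) - T' (SmoothL1.shift a φ)‖ < ε / 2 := by
      have hmem := hsub (SmoothL1.isVonNBounded_shift hB) (half_pos hε)
      have h1 : Tendsto (fun S : BoundedDistribution N => T - S) (𝓝 T) (𝓝 0) := by
        have : Continuous fun S : BoundedDistribution N => T - S :=
          continuous_const.sub continuous_id
        simpa using this.tendsto T
      obtain ⟨T', h2, hT'⟩ := mem_closure_iff_nhds.1 hT _ (h1 hmem)
      exact ⟨T', hT', fun a φ hφ => h2 _ ⟨a, φ, hφ, rfl⟩⟩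
    obtain ⟨t, ht, hcov⟩ := totallyBounded_iff_subset_finite_iUnion_nhds_zero.1
      ((IsCompact.totallyBounded hT').subset subset_closure) _ (hsub hB (half_pos hε))
    refine ⟨t, ht, ?_⟩
    rintro _ ⟨a, rfl⟩
    obtain ⟨y, hy, S, hS, hSy⟩ := Set.mem_iUnion₂.1 (hcov ⟨a, rfl⟩)
    refine Set.mem_iUnion₂.2 ⟨y, hy, distTranslate a T - y, hBU fun φ hφ => ?_, ?_⟩
    · have h3 : S = distTranslate a T' - y := by
        exact (add_sub_cancel_left y S).symm.trans (congrArg (· - y) hSy)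
      have h4 := hS φ hφ
      rw [h3] at h4
      have h5 := hTT' a φ hφ
      change ‖T (SmoothL1.shift a φ) - y φ‖ < ε
      change ‖T' (SmoothL1.shift a φ) - y φ‖ < ε / 2 at h4
      have := norm_sub_le_norm_sub_add_norm_sub (T (SmoothL1.shift a φ))
        (T' (SmoothL1.shift a φ)) (y φ)
      linarith
    · exact add_sub_cancel y _
  exact htb.closure.isCompact_of_isClosed isClosed_closure

end Distributions

/-! ### Mollification and density of `AP^∞` in `ℬ'_AP`. -/

section Approximation

variable {N : ℕ}

/-- A compactly supported smooth function as an element of `𝒟_{L¹}`. -/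
def SmoothL1.ofHasCompactSupport (f : Eu N → ℂ) (hf : ContDiff ℝ ∞ f) (hc : HasCompactSupport f) :
    SmoothL1 N :=
  ⟨f, hf, fun k => (hf.continuous_iteratedFDeriv (m := k)
    (mod_cast le_top)).integrable_of_hasCompactSupport (hc.iteratedFDeriv k)⟩

/-- An even mollifier supported in the ball of radius `ε`. -/
structure IsMollifier (θ : SmoothL1 N) (ε : ℝ) : Prop where
  hasCompactSupport : HasCompactSupport θ
  lintegral_le : ∫⁻ t, ‖θ t‖ₑ ≤ 1
  integral_eq : ∫ t, θ t = 1
  norm_le : ∀ t, θ t ≠ 0 → ‖t‖ ≤ ε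
  even : ∀ t, θ (-t) = θ t

lemma exists_isMollifier {ε : ℝ} (hε : 0 < ε) : ∃ θ : SmoothL1 N, IsMollifier θ ε := by
  let b : ContDiffBump (0 : Eu N) := ⟨ε / 2, ε, half_pos hε, half_lt_self hε⟩
  let f : Eu N → ℝ := b.normed volume
  have hf : ContDiff ℝ ∞ f := b.contDiff_normed
  have hc : HasCompactSupport fun x => (f x : ℂ) :=
    b.hasCompactSupport_normed.comp_left (g := Complex.ofReal) Complex.ofReal_zero
  have hi : ∫ x, f x = 1 := b.integral_normed
  refine ⟨SmoothL1.ofHasCompactSupport (fun x => (f x : ℂ))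
    (Complex.ofRealCLM.contDiff.comp hf) hc, hc, ?_, ?_, ?_, ?_⟩
  · change ∫⁻ t, ‖(f t : ℂ)‖ₑ ≤ 1
    have h1 : ∀ t, ‖(f t : ℂ)‖ₑ = ‖f t‖ₑ := fun t => by
      rw [← ofReal_norm, Complex.norm_real, ofReal_norm]
    simp only [h1]
    have h2 : ∀ t, ‖f t‖ = f t := fun t => Real.norm_of_nonneg (b.nonneg_normed t)
    rw [← ofReal_integral_norm_eq_lintegral_enorm (f := f) b.integrable_normed]
    simp only [h2, hi, ENNReal.ofReal_one, le_refl]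
  · change ∫ t, (f t : ℂ) = 1
    rw [integral_complex_ofReal, hi, Complex.ofReal_one]
  · intro t ht
    have ht' : t ∈ Function.support (b.normed volume) := fun h0 => ht (by
      change ((f t : ℝ) : ℂ) = 0
      rw [show f t = 0 from h0, Complex.ofReal_zero])
    rw [b.support_normed_eq, mem_ball_zero_iff] at ht'
    exact ht'.le
  · intro t
    change ((f (-t) : ℝ) : ℂ) = f t
    rw [show f (-t) = f t from b.normed_neg t]

/-- A sequence of mollifiers. -/
def mollifier (N n : ℕ) : SmoothL1 N :=
  (exists_isMollifier (N := N) (ε := 1 / ((n : ℝ) + 1)) (by positivity)).choose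

lemma isMollifier_mollifier (N n : ℕ) : IsMollifier (mollifier N n) (1 / ((n : ℝ) + 1)) :=
  (exists_isMollifier (N := N) (ε := 1 / ((n : ℝ) + 1)) (by positivity)).choose_spec

/-- Mollification on `𝒟_{L¹}`. -/
def mollify (n : ℕ) (φ : SmoothL1 N) : SmoothL1 N :=
  SmoothL1.conv (mollifier N n) (isMollifier_mollifier N n).hasCompactSupport φ

lemma norms_mollify_le (n k : ℕ) (φ : SmoothL1 N) :
    SmoothL1.norms N k (mollify n φ) ≤ SmoothL1.norms N k φ :=
  SmoothL1.norms_conv_le _ φ (isMollifier_mollifier N n).lintegral_le k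

lemma norms_mollify_sub_le (n k : ℕ) (φ : SmoothL1 N) :
    SmoothL1.norms N k (mollify n φ - φ) ≤
      1 / ((n : ℝ) + 1) * SmoothL1.norms N (k + 1) φ :=
  SmoothL1.norms_conv_sub_le _ φ (isMollifier_mollifier N n).lintegral_le
    (isMollifier_mollifier N n).integral_eq (isMollifier_mollifier N n).norm_le (by positivity) k

/-- Two mollifications give the factor `2`; the first does not increase the seminorms that bound the
error of the second. -/
lemma norms_mollify_mollify_sub_le (n k : ℕ) (φ : SmoothL1 N) :
    SmoothL1.norms N k (mollify n (mollify n φ) - φ) ≤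
      1 / ((n : ℝ) + 1) * (2 * SmoothL1.norms N (k + 1) φ) := by
  have h1 := norms_mollify_sub_le n k (mollify n φ)
  have h2 := norms_mollify_sub_le n k φ
  have h3 : 1 / ((n : ℝ) + 1) * SmoothL1.norms N (k + 1) (mollify n φ) ≤
      1 / ((n : ℝ) + 1) * SmoothL1.norms N (k + 1) φ := by
    gcongr
    exact norms_mollify_le n (k + 1) φ
  have h4 := map_add_le_add (SmoothL1.norms N k) (mollify n (mollify n φ) - mollify n φ)
    (mollify n φ - φ)
  rw [sub_add_sub_cancel] at h4
  linarith

/-- Mollification converges to the identity, uniformly on bounded sets. -/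
lemma eventually_apply_mollify_mollify (T : BoundedDistribution N) {B : Set (SmoothL1 N)}
    (hB : Bornology.IsVonNBounded ℂ B) {ε : ℝ} (hε : 0 < ε) :
    ∀ᶠ n in atTop, ∀ φ ∈ B, ‖T (mollify n (mollify n φ)) - T φ‖ < ε := by
  rw [SmoothL1.isVonNBounded_iff] at hB
  choose r hr hrB using hB
  obtain ⟨s, C, hC⟩ := T.exists_bound
  have hlim : Tendsto (fun n : ℕ => C * (1 / ((n : ℝ) + 1) * ∑ k ∈ s, 2 * r (k + 1)))
      atTop (𝓝 0) := by
    simpa using (tendsto_one_div_add_atTop_nhds_zero_nat (𝕜 := ℝ)).mul_const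
      (∑ k ∈ s, 2 * r (k + 1)) |>.const_mul (C : ℝ)
  filter_upwards [hlim.eventually (gt_mem_nhds hε)] with n hn φ hφ
  rw [← map_sub]
  refine ((hC _).trans ?_).trans_lt hn
  gcongr
  refine Seminorm.finset_sup_apply_le (mul_nonneg (by positivity)
    (Finset.sum_nonneg fun k _ => by linarith [hr (k + 1)])) fun k hk => ?_
  refine (norms_mollify_mollify_sub_le n k φ).trans ?_
  gcongr
  refine le_trans ?_ (Finset.single_le_sum (f := fun k => 2 * r (k + 1))
    (fun k _ => by linarith [hr (k + 1)]) hk)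
  linarith [hrB (k + 1) φ hφ]

/-- The convolution of bounded continuous functions with an integrable function. -/
def convBCF {F : Type*} [NormedAddCommGroup F] [NormedSpace ℂ F] (Θ : Eu N → F)
    (hΘ : Integrable Θ) : (Eu N →ᵇ ℂ) →L[ℂ] (Eu N →ᵇ F) :=
  have hint : ∀ (f : Eu N →ᵇ ℂ) (x : Eu N), Integrable fun t => f (x - t) • Θ t := fun f x =>
    hΘ.bdd_smul _ (f.continuous.comp (continuous_const.sub continuous_id)).aestronglyMeasurable
      (Eventually.of_forall fun t => f.norm_coe_le_norm (x - t))
  have hle : ∀ (f : Eu N →ᵇ ℂ) (x : Eu N), ‖∫ t, f (x - t) • Θ t‖ ≤ ‖f‖ * ∫ t, ‖Θ t‖ :=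
    fun f x => by
      rw [← integral_const_mul]
      refine norm_integral_le_of_norm_le (hΘ.norm.const_mul _) (Eventually.of_forall fun t => ?_)
      rw [norm_smul]
      gcongr
      exact f.norm_coe_le_norm _
  LinearMap.mkContinuous
    { toFun := fun f => BoundedContinuousFunction.ofNormedAddCommGroup
        (fun x => ∫ t, f (x - t) • Θ t)
        (continuous_of_dominated (fun x => (hint f x).aestronglyMeasurable)
          (fun x => Eventually.of_forall fun t => by
            rw [norm_smul]
            exact mul_le_mul_of_nonneg_right (f.norm_coe_le_norm _) (norm_nonneg _))
          (hΘ.norm.const_mul ‖f‖)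
          (Eventually.of_forall fun t => (f.continuous.comp
            (continuous_id.sub continuous_const)).smul continuous_const)) _ (hle f)
      map_add' := fun f g => by
        ext x
        change ∫ t, (f (x - t) + g (x - t)) • Θ t = (∫ t, f (x - t) • Θ t) + ∫ t, g (x - t) • Θ t
        rw [← integral_add (hint f x) (hint g x)]
        simp only [add_smul]
      map_smul' := fun c f => by
        ext x
        change ∫ t, (c * f (x - t)) • Θ t = c • ∫ t, f (x - t) • Θ t
        rw [← integral_smul]
        simp only [mul_smul] }
    (∫ t, ‖Θ t‖) fun f => by
      rw [mul_comm]
      exact (BoundedContinuousFunction.norm_le (mul_nonneg (norm_nonneg _)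
        (integral_nonneg fun _ => norm_nonneg _))).2 (hle f)

lemma convBCF_apply {F : Type*} [NormedAddCommGroup F] [NormedSpace ℂ F] {Θ : Eu N → F}
    (hΘ : Integrable Θ) (f : Eu N →ᵇ ℂ) (x : Eu N) :
    convBCF Θ hΘ f x = ∫ t, f (x - t) • Θ t := rfl

lemma isBohrAP_convBCF {F : Type*} [NormedAddCommGroup F] [NormedSpace ℂ F] {Θ : Eu N → F}
    (hΘ : Integrable Θ) {f : Eu N →ᵇ ℂ} (hf : IsBohrAP f) : IsBohrAP (convBCF Θ hΘ f) := by
  refine hf.map (convBCF Θ hΘ).continuous fun a => ?_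
  ext x
  simp only [bcfTranslate_apply, convBCF_apply]
  refine integral_congr_ae (Eventually.of_forall fun t => ?_)
  change f (x - t + a) • Θ t = f (x + a - t) • Θ t
  congr 2
  abel

/-- The convolution of an almost periodic function with a compactly supported test function. -/
def apConv (f : Eu N →ᵇ ℂ) (hf : IsBohrAP f) (θ : SmoothL1 N) (hθ : HasCompactSupport θ) :
    APInfty N :=
  ⟨fun x => ∫ t, f t • θ (x - t),
    (HasCompactSupport.convDominated_right f.continuous θ.2.1 hθ).contDiff f.continuous θ.2.1,
    fun k => by
      -- With the derivatives on `θ`, each one is a convolution of `f` with an integrable kernel of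
      -- multilinear maps, hence almost periodic.
      have : iteratedFDeriv ℝ k (fun x => ∫ t, f t • θ (x - t)) =
          convBCF (iteratedFDeriv ℝ k θ) (θ.integrable_deriv k) f := by
        ext1 x
        rw [(HasCompactSupport.convDominated_right f.continuous θ.2.1 hθ).iteratedFDeriv_eq
          f.continuous θ.2.1 k x, convBCF_apply, ← integral_sub_left_eq_self _ volume x]
        simp only [sub_sub_cancel]
      rw [this]
      exact isBohrAP_convBCF _ hf⟩

lemma apConv_apply (f : Eu N →ᵇ ℂ) (hf : IsBohrAP f) (θ : SmoothL1 N) (hθ : HasCompactSupport θ)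
    (x : Eu N) : apConv f hf θ hθ x = ∫ t, f t • θ (x - t) := rfl

/-- One convolution turns `T` into a function and the second places it in `AP^∞`. Evenness of `θ`
lets both pass to the test function without a reflection. -/
lemma distOfFun_apConv {T : BoundedDistribution N} (hT : T ∈ apDistributions N) {θ : SmoothL1 N}
    (hθ : HasCompactSupport θ) (heven : ∀ t, θ (-t) = θ t) (φ : SmoothL1 N) :
    distOfFun (apConv (evalBCF θ T) (isBohrAP_evalBCF θ hT) θ hθ) φ =
      T (SmoothL1.conv θ hθ (SmoothL1.conv θ hθ φ)) := by
  rw [BoundedDistribution.apply_conv]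
  set g := evalBCF θ T with hg
  change ∫ x, (∫ t, g t • θ (x - t)) * φ x = ∫ t, SmoothL1.conv θ hθ φ t • g t
  simp only [SmoothL1.conv_apply', ← integral_mul_const, smul_eq_mul]
  rw [integral_integral_swap]
  · refine integral_congr_ae (Eventually.of_forall fun t => ?_)
    refine integral_congr_ae (Eventually.of_forall fun x => ?_)
    change g t * θ (x - t) * φ x = φ x * θ (t - x) * g t
    rw [← heven (x - t), neg_sub]
    ring
  · have h1 : Integrable fun p : Eu N × Eu N => φ p.2 * θ (p.1 - p.2) :=
      Integrable.convolution_integrand (ContinuousLinearMap.mul ℝ ℂ) φ.integrable θ.integrable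
    have h2 := h1.swap.bdd_mul (f := fun p : Eu N × Eu N => g p.2) (c := ‖g‖)
      (g.continuous.comp continuous_snd).aestronglyMeasurable
      (Eventually.of_forall fun p => g.norm_coe_le_norm _)
    refine h2.congr (Eventually.of_forall fun p => ?_)
    change g p.2 * (φ p.1 * θ (p.2 - p.1)) = g p.2 * θ (p.1 - p.2) * φ p.1
    rw [← heven (p.1 - p.2), neg_sub]
    ring

/-- `AP^∞` is dense in the almost periodic distributions. -/
lemma exists_seq_tendsto_distOfFun {T : BoundedDistribution N} (hT : T ∈ apDistributions N) :
    ∃ u : ℕ → APInfty N, Tendsto (fun n => distOfFun (u n)) atTop (𝓝 T) := by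
  refine ⟨fun n => apConv (evalBCF (mollifier N n) T) (isBohrAP_evalBCF _ hT) (mollifier N n)
    (isMollifier_mollifier N n).hasCompactSupport, ?_⟩
  rw [← tendsto_sub_nhds_zero_iff, tendsto_zero_strongDual]
  intro B hB ε hε
  filter_upwards [eventually_apply_mollify_mollify T hB hε] with n hn φ hφ
  rw [sub_apply, distOfFun_apConv hT _ (isMollifier_mollifier N n).even]
  exact hn φ hφ

/-- By `BoundedDistribution.apply_conv`, `T` at a mollified function is an integral of values at
translates of the mollifier, all zero; and `T φ` is the limit of such values. -/
lemma eq_zero_of_evalBCF_eq_zero {T : BoundedDistribution N}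
    (h : ∀ θ : SmoothL1 N, HasCompactSupport θ → evalBCF θ T = 0) : T = 0 := by
  ext φ
  rw [zero_apply, ← norm_le_zero_iff]
  refine le_of_forall_pos_lt_add fun ε hε => ?_
  obtain ⟨n, hn⟩ := (eventually_apply_mollify_mollify T
    (Bornology.isVonNBounded_singleton (𝕜 := ℂ) φ) hε).exists
  have h0 : T (mollify n (mollify n φ)) = 0 := by
    rw [mollify, BoundedDistribution.apply_conv]
    have h1 : ∀ t, T (SmoothL1.shift t (mollifier N n)) = 0 := fun t =>
      DFunLike.congr_fun (h _ (isMollifier_mollifier N n).hasCompactSupport) t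
    simp [h1]
  have := hn φ rfl
  rwa [h0, zero_sub, norm_neg, ← zero_add ε] at this

end Approximation

/-! ### The mean value of distributions and the pairing with `𝒟_AP`. -/

section Pairing

variable {N : ℕ}

/-- Translation acts continuously on an almost periodic function. -/
lemma IsBohrAP.continuous_bcfTranslate {f : Eu N →ᵇ ℂ} (hf : IsBohrAP f) :
    Continuous fun a => bcfTranslate a f := by
  rw [isBohrAP_coe_iff] at hf
  set K := closure (Set.range fun a => bcfTranslate a f) with hK
  have : CompactSpace K := isCompact_iff_compactSpace.1 hf
  -- On the compact set `K` the uniform topology coincides with the pointwise one, so continuity of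
  -- `a ↦ f (x + a)` at each `x` suffices.
  have hev : Topology.IsClosedEmbedding fun (g : K) (x : Eu N) => g.1 x := by
    refine Continuous.isClosedEmbedding ?_ fun g h hgh =>
      Subtype.ext (BoundedContinuousFunction.ext fun x => congrFun hgh x)
    exact continuous_pi fun x =>
      (BoundedContinuousFunction.evalCLM ℂ x).continuous.comp continuous_subtype_val
  have h1 : Continuous fun a : Eu N => (⟨bcfTranslate a f, subset_closure ⟨a, rfl⟩⟩ : K) := by
    rw [hev.continuous_iff]
    exact continuous_pi fun x => f.continuous.comp (continuous_const.add continuous_id)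
  exact continuous_subtype_val.comp h1

/-- Interchange of the mean value with a convolution integral. -/
lemma meanForm_integral_smul {θ : SmoothL1 N} {G : Eu N → Eu N →ᵇ ℂ} (hG : Continuous G) {C : ℝ}
    (hC : ∀ t, ‖G t‖ ≤ C) {F : Eu N →ᵇ ℂ} (hF : ∀ x, F x = ∫ t, θ t • G t x) :
    meanForm N F = ∫ t, θ t • meanForm N (G t) := by
  have hint : Integrable fun t => θ t • G t := by
    refine (θ.integrable.norm.mul_const C).mono'
      (θ.continuous.smul hG).aestronglyMeasurable (Eventually.of_forall fun t => ?_)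
    rw [norm_smul]
    gcongr
    exact hC t
  have hFG : F = ∫ t, θ t • G t := by
    ext x
    have := (BoundedContinuousFunction.evalCLM ℂ x).integral_comp_comm hint
    rw [hF]
    exact this
  rw [hFG, ← (meanForm N).integral_comp_comm hint]
  simp only [map_smul]

/-- Both sides are integrals against `θ(t)`, of `𝔐(f(· - t) u)` and of `𝔐(f u(· + t))`; these agree
by translation invariance of the mean. -/
lemma meanForm_mul_convolution {f u : Eu N →ᵇ ℂ} (hf : IsBohrAP f) (hu : IsBohrAP u)
    {θ : SmoothL1 N} (hθ : HasCompactSupport θ) :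
    meanForm N ((apConv f hf θ hθ).toBCF * u) =
      meanForm N (f * evalBCF θ (distOfBCF N u)) := by
  have hnorm : ∀ (g : Eu N →ᵇ ℂ) (a : Eu N), ‖bcfTranslate a g‖ ≤ ‖g‖ := fun g a =>
    (BoundedContinuousFunction.norm_le (norm_nonneg _)).2 fun x => g.norm_coe_le_norm _
  rw [meanForm_integral_smul (θ := θ) (G := fun t => bcfTranslate (-t) f * u) (C := ‖f‖ * ‖u‖),
    meanForm_integral_smul (θ := θ) (G := fun t => f * bcfTranslate t u) (C := ‖f‖ * ‖u‖)]
  · refine integral_congr_ae (Eventually.of_forall fun t => ?_)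
    change θ t • meanForm N (bcfTranslate (-t) f * u) = θ t • meanForm N (f * bcfTranslate t u)
    rw [← meanForm_translate ((hf.translate (-t)).mul hu) t]
    congr 2
    ext x
    change f (x + t + -t) * u (x + t) = f x * u (x + t)
    rw [add_neg_cancel_right]
  · exact continuous_const.mul hu.continuous_bcfTranslate
  · exact fun t => (norm_mul_le _ _).trans
      (mul_le_mul_of_nonneg_left (hnorm u t) (norm_nonneg _))
  · intro x
    change f x * ∫ y, u y * θ (y - x) = _
    rw [← integral_const_mul, ← integral_add_right_eq_self _ x]
    refine integral_congr_ae (Eventually.of_forall fun t => ?_)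
    change f x * (u (t + x) * θ (t + x - x)) = θ t * (f x * u (x + t))
    rw [add_sub_cancel_right, add_comm x t]
    ring
  · exact (hf.continuous_bcfTranslate.comp continuous_neg).mul continuous_const
  · exact fun t => (norm_mul_le _ _).trans
      (mul_le_mul_of_nonneg_right (hnorm f _) (norm_nonneg _))
  · intro x
    change (apConv f hf θ hθ).toBCF x * u x = _
    rw [APInfty.toBCF_apply, apConv_apply, ← integral_mul_const,
      ← integral_sub_left_eq_self _ volume x]
    refine integral_congr_ae (Eventually.of_forall fun t => ?_)
    change f (x - t) * θ (x - (x - t)) * u x = θ t * (f (x + -t) * u x)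
    rw [sub_sub_cancel, sub_eq_add_neg]
    ring

/-- The mean value of bounded distributions: the mean value of `a ↦ ⟨T, η(· - a)⟩` for a test
function `η` with integral one. -/
def meanDist (N : ℕ) : BoundedDistribution N →L[ℂ] ℂ := meanForm N ∘L evalBCF (mollifier N 0)

lemma meanDist_apply (T : BoundedDistribution N) :
    meanDist N T = meanForm N (evalBCF (mollifier N 0) T) := rfl

lemma meanDist_distOfBCF {f : Eu N →ᵇ ℂ} (hf : IsBohrAP f) :
    meanDist N (distOfBCF N f) = meanForm N f := by
  rw [meanDist_apply, meanForm_evalBCF_distOfBCF hf, (isMollifier_mollifier N 0).integral_eq,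
    mul_one]

lemma isMeanValue_meanDist (u : APInfty N) : IsMeanValue u (meanDist N (distOfFun u)) := by
  rw [← u.coe_toBCF, isMeanValue_coe_iff, ← distOfBCF_toBCF, meanDist_distOfBCF u.isBohrAP_toBCF]
  exact meanRel_meanForm u.isBohrAP_toBCF

/-- For `T` in `AP^∞` this is a product of almost periodic functions; density and closedness of
`ℬ'_AP` give the rest. -/
lemma distMul_mem (φ : APInfty N) {T : BoundedDistribution N} (hT : T ∈ apDistributions N) :
    distMul φ T ∈ apDistributions N := by
  obtain ⟨u, hu⟩ := exists_seq_tendsto_distOfFun hT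
  refine (isClosed_apDistributions N).mem_of_tendsto
    (((continuous_distMul φ).tendsto T).comp hu) (Eventually.of_forall fun n => ?_)
  change distMul φ (distOfFun (u n)) ∈ apDistributions N
  rw [← distOfBCF_toBCF, distMul_distOfBCF]
  exact distOfBCF_mem (φ.isBohrAP_toBCF.mul (u n).isBohrAP_toBCF)

/-- Both sides are continuous in `T`, and on the dense subspace `AP^∞` the identity is
`meanForm_mul_convolution`. -/
lemma meanDist_distMul_apConv {T : BoundedDistribution N} (hT : T ∈ apDistributions N)
    {f : Eu N →ᵇ ℂ} (hf : IsBohrAP f) {θ : SmoothL1 N} (hθ : HasCompactSupport θ) :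
    meanDist N (distMul (apConv f hf θ hθ) T) = meanForm N (f * evalBCF θ T) := by
  obtain ⟨u, hu⟩ := exists_seq_tendsto_distOfFun hT
  have h1 := (((meanDist N).continuous.comp (continuous_distMul (apConv f hf θ hθ))).tendsto
    T).comp hu
  have hc : Continuous fun S : BoundedDistribution N => meanForm N (f * evalBCF θ S) :=
    (meanForm N).continuous.comp (continuous_const.mul (evalBCF θ).continuous)
  have h2 := (hc.tendsto T).comp hu
  refine tendsto_nhds_unique h1 (h2.congr fun n => ?_)
  change meanForm N (f * evalBCF θ (distOfFun (u n))) =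
    meanDist N (distMul (apConv f hf θ hθ) (distOfFun (u n)))
  rw [← distOfBCF_toBCF, distMul_distOfBCF, meanDist_distOfBCF
    ((APInfty.isBohrAP_toBCF _).mul (u n).isBohrAP_toBCF),
    meanForm_mul_convolution hf (u n).isBohrAP_toBCF hθ]

/-- With `g = evalBCF θ T`, testing against `φ = conj g * θ` produces `𝔐(|g|²)`. -/
lemma eq_zero_of_meanDist_distMul {T : BoundedDistribution N} (hT : T ∈ apDistributions N)
    (h : ∀ φ : APInfty N, meanDist N (distMul φ T) = 0) : T = 0 :=
  eq_zero_of_evalBCF_eq_zero fun θ hθ =>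
    (isBohrAP_evalBCF θ hT).eq_zero_of_meanForm_star_mul (by
      rw [← meanDist_distMul_apConv hT (isBohrAP_evalBCF θ hT).conj hθ]
      exact h _)

lemma norms_mulTest_le (u : APInfty N) (k : ℕ) (φ : SmoothL1 N) :
    SmoothL1.norms N k (mulTest u φ) ≤ ∑ i ∈ Finset.range (k + 1),
      (k.choose i * APInfty.derivSup N i u) * SmoothL1.norms N (k - i) φ := by
  have hint : ∀ i ∈ Finset.range (k + 1), Integrable (fun x =>
      (k.choose i * APInfty.derivSup N i u) * ‖iteratedFDeriv ℝ (k - i) φ x‖) volume :=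
    fun i _ => (φ.integrable_deriv _).norm.const_mul _
  refine (integral_mono_of_nonneg (Eventually.of_forall fun x => norm_nonneg _)
    (integrable_finsetSum _ hint) (Eventually.of_forall (leibniz_bound u k φ))).trans_eq ?_
  rw [integral_finsetSum _ hint]
  simp only [integral_const_mul, SmoothL1.norms_apply]

lemma derivSup_le_norms (u : APInfty N) (i : ℕ) :
    APInfty.derivSup N i u ≤ APInfty.norms N i u :=
  Seminorm.le_finset_sup_apply (Finset.mem_range.2 i.lt_succ_self)

/-- The products of the elements of a bounded subset of `𝒟_AP` with the translates of a test
function form a bounded set. -/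
lemma isVonNBounded_mulTest_shift {B : Set (DAP N)} (hB : Bornology.IsVonNBounded ℂ B)
    (η : SmoothL1 N) : Bornology.IsVonNBounded ℂ
      {ψ | ∃ d ∈ B, ∃ a, ψ = mulTest ((DAP.rho N).symm d) (SmoothL1.shift a η)} := by
  rw [(DAP.withSeminorms N).isVonNBounded_iff_seminorm_bounded] at hB
  choose r hr hrB using hB
  rw [SmoothL1.isVonNBounded_iff]
  intro k
  refine ⟨∑ i ∈ Finset.range (k + 1), (k.choose i * r i) * SmoothL1.norms N (k - i) η + 1, ?_, ?_⟩
  · have : 0 ≤ ∑ i ∈ Finset.range (k + 1), (k.choose i * r i) * SmoothL1.norms N (k - i) η :=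
      Finset.sum_nonneg fun i _ =>
        mul_nonneg (mul_nonneg (Nat.cast_nonneg _) (hr i).le) (apply_nonneg _ _)
    linarith
  · rintro _ ⟨d, hd, a, rfl⟩
    refine ((norms_mulTest_le _ k _).trans ?_).trans_lt (lt_add_one _)
    refine Finset.sum_le_sum fun i _ => ?_
    rw [SmoothL1.norms_shift]
    gcongr
    exact (derivSup_le_norms _ i).trans (hrB i d hd).le

lemma norm_meanDist_le {S : BoundedDistribution N} {C : ℝ} (hC : 0 ≤ C)
    (h : ∀ a, ‖S (SmoothL1.shift a (mollifier N 0))‖ ≤ C) :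
    ‖meanDist N S‖ ≤ ‖meanForm N‖ * C := by
  refine ((meanForm N).le_opNorm _).trans ?_
  gcongr
  exact (BoundedContinuousFunction.norm_le hC).2 h

lemma distMul_add (u v : APInfty N) (T : BoundedDistribution N) :
    distMul (u + v) T = distMul u T + distMul v T := by
  ext φ
  have h : mulTest (u + v) φ = mulTest u φ + mulTest v φ :=
    SmoothL1.ext' fun x => add_mul (u x) (v x) (φ x)
  rw [add_apply, distMul_apply, distMul_apply, distMul_apply, h, map_add]

lemma distMul_smul (c : ℂ) (u : APInfty N) (T : BoundedDistribution N) :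
    distMul (c • u) T = c • distMul u T := by
  ext φ
  have h : mulTest (c • u) φ = c • mulTest u φ :=
    SmoothL1.ext' fun x => mul_assoc c (u x) (φ x)
  rw [smul_apply, distMul_apply, distMul_apply, h, map_smul]

/-- The linear form `ϱ(φ) ↦ 𝔐(φT)`. -/
def pairingForm (T : BoundedDistribution N) : DAP N →ₗ[ℂ] ℂ where
  toFun d := meanDist N (distMul ((DAP.rho N).symm d) T)
  map_add' d e := by
    rw [← map_add (meanDist N), map_add (DAP.rho N).symm, distMul_add]
  map_smul' c d := by
    rw [RingHom.id_apply, ← map_smul (meanDist N), map_smul (DAP.rho N).symm, distMul_smul]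

/-- `𝔐(φT)` is bounded by the values of `T` on the products of `φ` with translates of one mollifier;
for `ϱ(φ)` in a bounded set these products form a bounded set. -/
lemma continuous_pairingForm (T : BoundedDistribution N) : Continuous (pairingForm T) := by
  refine (pairingForm T).continuous_of_locally_bounded fun B hB => ?_
  have hB' := (isVonNBounded_mulTest_shift hB (mollifier N 0)).image T
  rw [NormedSpace.isVonNBounded_iff, isBounded_iff_forall_norm_le] at hB'
  obtain ⟨C, hC⟩ := hB'
  rw [NormedSpace.isVonNBounded_iff, isBounded_iff_forall_norm_le]
  refine ⟨‖meanForm N‖ * max C 0, ?_⟩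
  rintro _ ⟨d, hd, rfl⟩
  exact norm_meanDist_le (le_max_right _ _) fun a =>
    (hC _ ⟨_, ⟨d, hd, a, rfl⟩, rfl⟩).trans (le_max_left _ _)

/-- The map `T ↦ (ϱ(φ) ↦ 𝔐(φT))`, as a linear map on the bounded distributions. -/
def pairingLinear (N : ℕ) : BoundedDistribution N →ₗ[ℂ] DAPDual N where
  toFun T := ⟨pairingForm T, continuous_pairingForm T⟩
  map_add' S T := ContinuousLinearMap.ext fun d =>
    map_add (meanDist N) (distMul ((DAP.rho N).symm d) S) (distMul ((DAP.rho N).symm d) T)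
  map_smul' c T := ContinuousLinearMap.ext fun d =>
    map_smul (meanDist N) c (distMul ((DAP.rho N).symm d) T)

/-- The map `T ↦ (ϱ(φ) ↦ 𝔐(φT))`. -/
def pairing (N : ℕ) : BoundedDistribution N →L[ℂ] DAPDual N where
  toLinearMap := pairingLinear N
  cont := by
    change Continuous (pairingLinear N)
    refine continuous_of_continuousAt_zero (pairingLinear N) ?_
    rw [ContinuousAt, map_zero, tendsto_zero_strongDual]
    intro B hB ε hε
    have hδ : 0 < ε / (‖meanForm N‖ + 1) := by positivity
    filter_upwards [tendsto_zero_strongDual.1 (tendsto_id (α := BoundedDistribution N)) _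
      (isVonNBounded_mulTest_shift hB (mollifier N 0)) _ hδ] with T hT d hd
    have h1 : ‖pairingLinear N T d‖ ≤ ‖meanForm N‖ * (ε / (‖meanForm N‖ + 1)) :=
      norm_meanDist_le hδ.le fun a => (hT _ ⟨d, hd, a, rfl⟩).le
    refine h1.trans_lt ?_
    rw [mul_div_assoc', div_lt_iff₀ (by positivity)]
    linarith

lemma pairing_rho (T : BoundedDistribution N) (φ : APInfty N) :
    pairing N T (DAP.rho N φ) = meanDist N (distMul φ T) := by
  change meanDist N (distMul ((DAP.rho N).symm (DAP.rho N φ)) T) = _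
  rw [LinearEquiv.symm_apply_apply]

end Pairing

end APDist

end

theorem mainTheorem7 (N : ℕ) :
    ∃ M : APDist.apDistributions N →L[ℂ] ℂ,
      (APDist.ExtendsMeanValue M ∧
        ∀ M' : APDist.apDistributions N →L[ℂ] ℂ, APDist.ExtendsMeanValue M' → M' = M) ∧
      ∃ Φ : APDist.apDistributions N →L[ℂ] APDist.DAPDual N,
        (∀ (T : APDist.apDistributions N) (φ : APDist.APInfty N),
          ∃ h : APDist.distMul φ (T : APDist.BoundedDistribution N) ∈ APDist.apDistributions N,
            Φ T (APDist.DAP.rho N φ) = M ⟨APDist.distMul φ T, h⟩) ∧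
        Function.Injective Φ := by
  -- Both maps live on all of `ℬ'_∞` through the Hahn–Banach extension `meanForm`; only their
  -- restrictions to `ℬ'_AP` are canonical.
  refine ⟨APDist.meanDist N ∘L (APDist.apDistributions N).subtypeL,
    ⟨fun u => ⟨APDist.distOfFun_mem u, APDist.isMeanValue_meanDist u⟩, fun M' hM' => ?_⟩,
    APDist.pairing N ∘L (APDist.apDistributions N).subtypeL,
    fun T φ => ⟨APDist.distMul_mem φ T.2, APDist.pairing_rho _ φ⟩, ?_⟩
  -- Two extensions agree on `AP^∞` by uniqueness of the mean value, hence everywhere by density and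
  -- continuity.
  · ext T
    obtain ⟨u, hu⟩ := APDist.exists_seq_tendsto_distOfFun T.2
    have hu' : Tendsto (fun n => (⟨APDist.distOfFun (u n), APDist.distOfFun_mem (u n)⟩ :
        APDist.apDistributions N)) atTop (𝓝 T) := tendsto_subtype_rng.2 hu
    refine tendsto_nhds_unique ((M'.continuous.tendsto T).comp hu')
      ((((APDist.meanDist N).continuous.tendsto T).comp hu).congr fun n => ?_)
    obtain ⟨h, hmean⟩ := hM' (u n)
    have h1 := APDist.isMeanValue_meanDist (u n)
    rw [← (u n).coe_toBCF, APDist.isMeanValue_coe_iff] at hmean h1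
    exact h1.unique hmean
  · rw [injective_iff_map_eq_zero]
    intro T hT
    refine Subtype.ext (APDist.eq_zero_of_meanDist_distMul T.2 fun φ => ?_)
    rw [← APDist.pairing_rho]
    exact DFunLike.congr_fun hT _
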